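/- **The puzzle.** There are three posts $S, I, D$ and $N\ge 0$ disks of different sizes, each with a red and a blue side. A move takes the top disk of a post, turns it over and puts it on another post; it may be put only on an empty post or on a larger disk (size rule), and if it is put on a disk then the two touching sides must have different colors (magnetic rule). In the Free puzzle (all three posts neutral) there are no other restrictions. The task is to bring the tower of all $N$ disks from $S$, all red side up, to $D$, all blue side up. **The algorithms.** Every procedure below, called with $(n,s,d,i)$, acts on the $n$ smallest disks; $[m: s\to d]$ is the move of the $m$-th smallest disk from $s$ to $d$; procedures with $n=0$ do nothing, and the procedures $727$ and $636$ with $n=1$ are the single move $[1: s\to d]$. For the other $n$ ($n\ge1$, respectively $n\ge 2$ for $727$ and $636$), carry out in order: * $RBB_{1000}$: $RBB_{1000}(n-1,s,i,d)$, $[n:s\to d]$, $RRB_{1000}(n-1,i,s,d)$, $RBB_{1000}(n-1,s,d,i)$. * $RRB_{1000}$: $RRB_{1000}(n-1,s,d,i)$, $RBB_{1000}(n-1,d,i,s)$, $[n:s\to d]$, $RRB_{1000}(n-1,i,d,s)$. * $RBN_{909}$: $RNB_{727}(n-1,s,i,d)$, $[n:s\to d]$, $RRB_{1000}(n-1,i,s,d)$,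 $RBB_{1000}(n-1,s,d,i)$. * $NRB_{909}$: $RRB_{1000}(n-1,s,d,i)$, $RBB_{1000}(n-1,d,i,s)$, $[n:s\to d]$, $BNR_{727}(n-1,i,d,s)$. * $RNB_{727}$: $RBN_{909}(n-1,s,i,d)$, then the sequence $U$, which is $[n:s\to d]$, $RRB_{1000}(n-2,i,s,d)$, $RBB_{1000}(n-2,s,d,i)$, $[n-1:i\to s]$, $RBN_{909}(n-2,d,i,s)$, $[n-1:s\to d]$, $NRB_{909}(n-2,i,d,s)$. * $BNR_{727}$: the sequence $V$, which is $RBN_{909}(n-2,s,i,d)$, $[n-1:s\to d]$, $NRB_{909}(n-2,i,s,d)$, $[n-1:d\to i]$, $RRB_{1000}(n-2,s,d,i)$, $RBB_{1000}(n-2,d,i,s)$, $[n:s\to d]$; then $NRB_{909}(n-1,i,d,s)$. * $RNN_{636}$: $RNN_{636}(n-1,s,i,d)$, then $U$. $\quad NNB_{636}$: $V$, then $NNB_{636}(n-1,i,d,s)$. * $\mathrm{AllButUp}$: $RRB_{1000}(n-1,s,i,d)$, $RBB_{1000}(n-1,i,d,s)$, $[n:s\to i]$, $RBN_{909}(n-1,d,s,i)$,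 $[n:i\to d]$, $NNB_{636}(n-1,s,d,i)$. * $\mathrm{AllButDown}$: $RNN_{636}(n-1,s,d,i)$, $[n:s\to i]$, $NRB_{909}(n-1,d,s,i)$, $[n:i\to d]$, $RRB_{1000}(n-1,s,i,d)$, $RBB_{1000}(n-1,i,d,s)$. * Up-606: $RNN_{636}(n-1,s,i,d)$, $[n:s\to d]$, $\mathrm{AllButUp}(n-1,i,d,s)$. * Down-606: $\mathrm{AllButDown}(n-1,s,i,d)$, $[n:s\to d]$, $NNB_{636}(n-1,i,d,s)$. Let $S_{1000}(N), S_{909}(N), S_{636}(N), S_{606}(N)$ be the numbers of moves of $RBB_{1000}$, $RBN_{909}$, $RNN_{636}$, Up-606 called with $(N,S,D,I)$, and let $P_{1000}(k),P_{909}(k),P_{636}(k),P_{606}(k)$ be the numbers of moves that the $k$-th largest disk makes in them, taken for $N=k$. Let $$\lambda_1=\sqrt[3]{1+\sqrt{26/27}}+\sqrt[3]{1-\sqrt{26/27}},\qquad \lambda_{2,3}=-\tfrac12\lambda_1\pm\tfrac i2\Bigl[\sqrt[3]{\sqrt{27}+\sqrt{26}}-\sqrt[3]{\sqrt{27}-\sqrt{26}}\Bigr],$$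 $$\sigma(x;y,z)=\frac{\frac7{11}yz-\frac{10}{11}(y+z)+\frac{19}{11}}{(y-x)(z-x)},\qquad \pi(x;y,z)=\frac{\frac1{11}yz-\frac{3}{11}(y+z)+\frac{9}{11}}{(y-x)(z-x)},$$ and let $A_S,B_S,C_S$ be $\sigma(\lambda_1;\lambda_2,\lambda_3)$, $\sigma(\lambda_2;\lambda_1,\lambda_3)$, $\sigma(\lambda_3;\lambda_1,\lambda_2)$ and $A_P,B_P,C_P$ the same values of $\pi$. **Theorem.** 1. For every $N\ge 0$, each of Up-606 and Down-606, called with $(N,S,D,I)$, consists of legal moves, solves the Free puzzle with $N$ disks, and no sequence of legal moves that solves it is shorter. Both have $S_{606}(N)$ moves, which is thus the minimum number of moves. 2. $S_{606}(1)=1$, $S_{606}(2)=4$, and $S_{606}(N+1)=S_{636}(N)+S_{636}(N-1)+S_{909}(N-1)+2S_{1000}(N-1)+3$ for all $N\ge 1$. 3. For $1\le k\le N$, the $k$-th largest of $N$ disks makes exactly $P_{606}(k)$ moves in Up-606 and in Down-606. Moreover $P_{606}(1)=1$, $P_{606}(2)=3$, and $P_{606}(k+1)=P_{636}(k)+P_{636}(k-1)+P_{909}(k-1)+2P_{1000}(k-1)$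 for all $k\ge 2$. 4. For all $N\ge1$ and all $k\ge 2$, $$S_{606}(N)=\tfrac{10}{33}3^N+\tfrac12A_S(\lambda_1+1)^2\lambda_1^{N-1}+\tfrac12B_S(\lambda_2+1)^2\lambda_2^{N-1}+\tfrac12C_S(\lambda_3+1)^2\lambda_3^{N-1}-2,$$ $$P_{606}(k)=\tfrac{20}{33}3^{k-1}+\tfrac12A_P(\lambda_1+1)^2\lambda_1^{k-1}+\tfrac12B_P(\lambda_2+1)^2\lambda_2^{k-1}+\tfrac12C_P(\lambda_3+1)^2\lambda_3^{k-1}.$$ 5. $S_{1000}(N)=(3^N-1)/2$ for all $N\ge 0$, and $$\lim_{N\to\infty}\frac{S_{606}(N)}{(3^N-1)/2}=\frac{20}{33}.$$ The minimum number of moves for the Free puzzle, divided by $(3^N-1)/2$, has the same limit $20/33$, the optimal duration limit. -/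

import Mathlib

open Filter Topology

namespace MToH

/-! ### The puzzle -/

/-- The three posts: Source, Intermediate, Destination. -/
inductive Post
  | S
  | I
  | D
  deriving DecidableEq

/-- The two sides of a disk. -/
inductive Color
  | red
  | blue
  deriving DecidableEq

/-- The opposite side of a disk. -/
def Color.flip : Color → Color
  | red => blue
  | blue => red

/-- An arrangement of `N` disks. Disks are numbered by size, `0` being the smallest. On every post
the disks are stacked by size (the size rule never allows anything else), so an arrangement is given
by the post of each disk and the color that each disk shows facing up. -/
structure Config (N : ℕ) where
  post : Fin N → Post
  up : Fin N → Color

/-- Disk `e` is the top disk of post `p`: it lies there and no smaller disk does. -/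
def Config.IsTop {N : ℕ} (x : Config N) (e : Fin N) (p : Post) : Prop :=
  x.post e = p ∧ ∀ f : Fin N, x.post f = p → e ≤ f

/-- Put disk `e` on post `p` and turn it over. -/
def Config.moveDisk {N : ℕ} (x : Config N) (e : Fin N) (p : Post) : Config N where
  post := Function.update x.post e p
  up := Function.update x.up e (x.up e).flip

/-- The `N` disks form a tower on post `p`, all of them showing the color `c`. -/
def Config.tower (N : ℕ) (p : Post) (c : Color) : Config N where
  post := fun _ => p
  up := fun _ => c

/-- The instruction "move disk number `disk` from post `src` to post `dst`". -/
structure Move where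
  disk : ℕ
  src : Post
  dst : Post

/-- A pre-coloring of the posts; `none` means that the post is neutral. -/
abbrev PreColoring := Post → Option Color

/-- All three posts are neutral. -/
def free : PreColoring := fun _ => none

/-- `m` is a legal move that leads from `x` to `y`: the top disk `e` of the source post is turned
over and put on another post. If that post is occupied, its top disk `f` has to be larger than `e`
(size rule), and the two touching sides (the upper side of `f` and the side of `e` that faced up
before the move) have to be of opposite colors (magnetic rule). On a post pre-colored with `c`, the
disk has to show `c` facing up after the move. -/
def LegalMove {N : ℕ} (pre : PreColoring) (m : Move) (x y : Config N) : Prop :=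
  ∃ e : Fin N, (e : ℕ) = m.disk ∧ m.src ≠ m.dst ∧ x.IsTop e m.src ∧
    (∀ f : Fin N, x.IsTop f m.dst → e < f ∧ x.up f ≠ x.up e) ∧
    (∀ c : Color, pre m.dst = some c → (x.up e).flip = c) ∧
    y = x.moveDisk e m.dst

/-- Executing the instructions of the list in order is legal and leads from the first to the second
arrangement. -/
def Plays {N : ℕ} (pre : PreColoring) : List Move → Config N → Config N → Prop
  | [], x, y => x = y
  | m :: L, x, z => ∃ y : Config N, LegalMove pre m x y ∧ Plays pre L y z

/-- The list moves the tower of `N` disks from red-up on `S` to blue-up on `D`. -/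
def Solves (pre : PreColoring) (N : ℕ) (L : List Move) : Prop :=
  Plays pre L (Config.tower N Post.S Color.red) (Config.tower N Post.D Color.blue)

/-- The list solves the puzzle, and no shorter list does. -/
def IsOptimalSolution (pre : PreColoring) (N : ℕ) (L : List Move) : Prop :=
  Solves pre N L ∧ ∀ L' : List Move, Solves pre N L' → L.length ≤ L'.length

/-- The minimum number of moves that solves the puzzle with `N` disks. -/
noncomputable def minMoves (pre : PreColoring) (N : ℕ) : ℕ :=
  sInf {k : ℕ | ∃ L : List Move, Solves pre N L ∧ L.length = k}

/-! ### The algorithms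

Every algorithm, called with `n s d i`, transports the `n` smallest disks from `s` to `d` using `i`.
The `n`-th smallest disk has number `n - 1`. -/

mutual
/-- Source and intermediate post of opposite colors, intermediate and destination of equal ones. -/
def SRBB1000 : ℕ → Post → Post → Post → List Move
  | 0, _, _, _ => []
  | n + 1, s, d, i =>
      SRBB1000 n s i d ++ [⟨n, s, d⟩] ++ SRRB1000 n i s d ++ SRBB1000 n s d i
/-- Source and intermediate post of equal colors, destination of the opposite one. -/
def SRRB1000 : ℕ → Post → Post → Post → List Move
  | 0, _, _, _ => []
  | n + 1, s, d, i =>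
      SRRB1000 n s d i ++ SRBB1000 n d i s ++ [⟨n, s, d⟩] ++ SRRB1000 n i d s
end

mutual
/-- Source and intermediate post of opposite colors, destination neutral. -/
def SRBN909 : ℕ → Post → Post → Post → List Move
  | 0, _, _, _ => []
  | n + 1, s, d, i =>
      SRNB727 n s i d ++ [⟨n, s, d⟩] ++ SRRB1000 n i s d ++ SRBB1000 n s d i
/-- Source neutral, intermediate and destination post of opposite colors. -/
def SNRB909 : ℕ → Post → Post → Post → List Move
  | 0, _, _, _ => []
  | n + 1, s, d, i =>
      SRRB1000 n s d i ++ SRBB1000 n d i s ++ [⟨n, s, d⟩] ++ SBNR727 n i d s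
/-- Source and destination post of opposite colors, intermediate neutral. -/
def SRNB727 : ℕ → Post → Post → Post → List Move
  | 0, _, _, _ => []
  | 1, s, d, _ => [⟨0, s, d⟩]
  | n + 2, s, d, i =>
      SRBN909 (n + 1) s i d ++ [⟨n + 1, s, d⟩] ++ SRRB1000 n i s d ++ SRBB1000 n s d i ++
        [⟨n, i, s⟩] ++ SRBN909 n d i s ++ [⟨n, s, d⟩] ++ SNRB909 n i d s
/-- The time reversal of `SRNB727`, for the same pre-coloring. -/
def SBNR727 : ℕ → Post → Post → Post → List Move
  | 0, _, _, _ => []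
  | 1, s, d, _ => [⟨0, s, d⟩]
  | n + 2, s, d, i =>
      SRBN909 n s i d ++ [⟨n, s, d⟩] ++ SNRB909 n i s d ++ [⟨n, d, i⟩] ++ SRRB1000 n s d i ++
        SRBB1000 n d i s ++ [⟨n + 1, s, d⟩] ++ SNRB909 (n + 1) i d s
end

/-- Source post colored, the other two neutral. -/
def SRNN636 : ℕ → Post → Post → Post → List Move
  | 0, _, _, _ => []
  | 1, s, d, _ => [⟨0, s, d⟩]
  | n + 2, s, d, i =>
      SRNN636 (n + 1) s i d ++ [⟨n + 1, s, d⟩] ++ SRRB1000 n i s d ++ SRBB1000 n s d i ++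
        [⟨n, i, s⟩] ++ SRBN909 n d i s ++ [⟨n, s, d⟩] ++ SNRB909 n i d s

/-- Destination post colored, the other two neutral. -/
def SNNB636 : ℕ → Post → Post → Post → List Move
  | 0, _, _, _ => []
  | 1, s, d, _ => [⟨0, s, d⟩]
  | n + 2, s, d, i =>
      SRBN909 n s i d ++ [⟨n, s, d⟩] ++ SNRB909 n i s d ++ [⟨n, d, i⟩] ++ SRRB1000 n s d i ++
        SRBB1000 n d i s ++ [⟨n + 1, s, d⟩] ++ SNNB636 (n + 1) i d s

def moveAllButNUp606 : ℕ → Post → Post → Post → List Move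
  | 0, _, _, _ => []
  | n + 1, s, d, i =>
      SRRB1000 n s i d ++ SRBB1000 n i d s ++ [⟨n, s, i⟩] ++ SRBN909 n d s i ++ [⟨n, i, d⟩] ++
        SNNB636 n s d i

def moveAllButNDown606 : ℕ → Post → Post → Post → List Move
  | 0, _, _, _ => []
  | n + 1, s, d, i =>
      SRNN636 n s d i ++ [⟨n, s, i⟩] ++ SNRB909 n d s i ++ [⟨n, i, d⟩] ++ SRRB1000 n s i d ++
        SRBB1000 n i d s

/-- The "up" version of the "606" algorithm. -/
def solveUp606 : ℕ → Post → Post → Post → List Move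
  | 0, _, _, _ => []
  | n + 1, s, d, i => SRNN636 n s i d ++ [⟨n, s, d⟩] ++ moveAllButNUp606 n i d s

/-- The "down" version of the "606" algorithm. -/
def solveDown606 : ℕ → Post → Post → Post → List Move
  | 0, _, _, _ => []
  | n + 1, s, d, i => moveAllButNDown606 n s i d ++ [⟨n, s, d⟩] ++ SNNB636 n i d s

/-! ### Numbers of moves -/

/-- Total numbers of moves for `N` disks. -/
def S1000 (N : ℕ) : ℕ := (SRBB1000 N Post.S Post.D Post.I).length
def S909 (N : ℕ) : ℕ := (SRBN909 N Post.S Post.D Post.I).length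
def S636 (N : ℕ) : ℕ := (SRNN636 N Post.S Post.D Post.I).length
def S606 (N : ℕ) : ℕ := (solveUp606 N Post.S Post.D Post.I).length

/-- The number of moves of disk number `j` in a list of moves. -/
def movesOf (j : ℕ) (L : List Move) : ℕ := L.countP (fun m => m.disk = j)

/-- The number of moves of the `k`-th largest disk, `k ≥ 1`, read off from the run with `k` disks,
where it is the smallest one. -/
def P1000 (k : ℕ) : ℕ := movesOf 0 (SRBB1000 k Post.S Post.D Post.I)
def P909 (k : ℕ) : ℕ := movesOf 0 (SRBN909 k Post.S Post.D Post.I)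
def P636 (k : ℕ) : ℕ := movesOf 0 (SRNN636 k Post.S Post.D Post.I)
def P606 (k : ℕ) : ℕ := movesOf 0 (solveUp606 k Post.S Post.D Post.I)

/-! ### The constants of the closed forms -/

/-- The real cube root of a non-negative number. -/
noncomputable def cbrt (x : ℝ) : ℝ := x ^ ((1 : ℝ) / 3)

noncomputable def lam1 : ℂ :=
  ((cbrt (1 + √(26 / 27)) + cbrt (1 - √(26 / 27)) : ℝ) : ℂ)

noncomputable def lam2 : ℂ :=
  -(1 / 2) * lam1 + Complex.I / 2 * ((cbrt (√27 + √26) - cbrt (√27 - √26) : ℝ) : ℂ)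

noncomputable def lam3 : ℂ :=
  -(1 / 2) * lam1 - Complex.I / 2 * ((cbrt (√27 + √26) - cbrt (√27 - √26) : ℝ) : ℂ)

/-- The common shape of the coefficients: the value that belongs to the root `x`, where `y` and `z`
are the other two roots. -/
noncomputable def coeffS (x y z : ℂ) : ℂ :=
  (7 / 11 * (y * z) - 10 / 11 * (y + z) + 19 / 11) / ((y - x) * (z - x))

noncomputable def coeffP (x y z : ℂ) : ℂ :=
  (1 / 11 * (y * z) - 3 / 11 * (y + z) + 9 / 11) / ((y - x) * (z - x))

noncomputable def AS : ℂ := coeffS lam1 lam2 lam3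
noncomputable def BS : ℂ := coeffS lam2 lam1 lam3
noncomputable def CS : ℂ := coeffS lam3 lam1 lam2
noncomputable def AP : ℂ := coeffP lam1 lam2 lam3
noncomputable def BP : ℂ := coeffP lam2 lam1 lam3
noncomputable def CP : ℂ := coeffP lam3 lam1 lam2

end MToH

/-!
The size rule and the magnetic rule force all the disks on one post to show the same color. So when
the largest disk moves, the other disks form a tower on the third post, and a play of `n + 1` disks
is a walk of the largest disk between the posts, interleaved with plays of `n` disks from tower to
tower, for which the largest disk acts as the color of the post where it lies.

*Legality.* `Plays.snoc` turns a play of the smaller disks, under the pre-coloring painted by the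
largest disk, into a play of all the disks. With it, each procedure is shown by induction to take a
tower to its destination, for every pre-coloring that meets its requirement (`Transports`).

*Optimality.* By induction on the number of disks, and for all pre-colorings and all pairs of towers
at once, the number of moves between the towers is bounded below by a table `bound`. Its entries are
linear forms in the four sequences `full 1 m = (3 ^ m - 1) / 2`, `saved 1 m`, `saved 1 (m + 1)`,
`saved 1 (m + 2)`, where `saved` is the difference between the lengths of `SRBB1000` and `SRBN909`.
The induction step is a shortest-path bound on the finite graph of pairs (spot of the largest disk,
spot of the tower of the others): `potential` is a potential on this graph, and it has to satisfy
finitely many inequalities between linear forms (`Closed`). Since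
`full 1 m ≥ saved 1 (m + 2) ≥ saved 1 (m + 1) ≥ saved 1 m ≥ 0`, each of them follows from
inequalities between partial sums of the integer coefficients, and `closed_bound` has the kernel
evaluate these. The entry for three neutral posts is the number of moves of the 606 algorithm.

*Counting.* Total numbers of moves and numbers of moves of a single disk are both total weights, for
the weights `1` and `Pi.single j 1` on the disks. For every weight, the totals of all procedures are
`full` minus a sum of consecutive terms of `saved`, whose recursion has the characteristic
polynomial `X ^ 3 - X - 2`, up to an inhomogeneity from `full`. The numbers `lam1`, `lam2`, `lam3`
are its roots, by Cardano's formula, and the closed forms follow by comparing three initial values.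
-/

namespace MToH

/-! ### Plays on towers, and adding a largest disk -/

@[simp] theorem Color.flip_flip (c : Color) : c.flip.flip = c := by cases c <;> rfl

theorem Color.flip_ne (c : Color) : c.flip ≠ c := by cases c <;> decide

theorem Color.eq_flip_of_ne {c e : Color} (h : c ≠ e) : c = e.flip := by
  cases c <;> cases e <;> first | rfl | exact absurd rfl h

/-- The pre-coloring `pre` admits disks showing the color `c` on post `p`. -/
def Allows (pre : PreColoring) (p : Post) (c : Color) : Prop := ∀ c', pre p = some c' → c = c'

/-- The pre-coloring seen by the smaller disks when a larger disk showing `c` lies on post `p`. -/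
def PreColoring.paint (pre : PreColoring) (p : Post) (c : Color) : PreColoring :=
  Function.update pre p (some c)

@[simp] theorem PreColoring.paint_self (pre : PreColoring) (p : Post) (c : Color) :
    pre.paint p c p = some c := by simp [PreColoring.paint]

theorem PreColoring.paint_of_ne (pre : PreColoring) {p q : Post} (c : Color) (h : q ≠ p) :
    pre.paint p c q = pre q := by simp [PreColoring.paint, h]

theorem Config.ext' {N : ℕ} {x y : Config N} (h : ∀ e, x.post e = y.post e)
    (h' : ∀ e, x.up e = y.up e) : x = y := by
  cases x; cases y; congr 1
  · exact funext h
  · exact funext h'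

instance : Subsingleton (Config 0) :=
  ⟨fun _ _ => Config.ext' (fun e => e.elim0) (fun e => e.elim0)⟩

/-- The arrangement `x` together with an additional largest disk, which lies on post `p` and
shows the color `c`. -/
def Config.snoc {n : ℕ} (x : Config n) (p : Post) (c : Color) : Config (n + 1) where
  post := Fin.snoc (α := fun _ => Post) x.post p
  up := Fin.snoc (α := fun _ => Color) x.up c

section Snoc

variable {n : ℕ} (x : Config n) (p : Post) (c : Color)

@[simp] theorem Config.snoc_post_castSucc (e : Fin n) :
    (x.snoc p c).post e.castSucc = x.post e := by simp [Config.snoc]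

@[simp] theorem Config.snoc_post_last : (x.snoc p c).post (Fin.last n) = p := by
  simp [Config.snoc]

@[simp] theorem Config.snoc_up_castSucc (e : Fin n) :
    (x.snoc p c).up e.castSucc = x.up e := by simp [Config.snoc]

@[simp] theorem Config.snoc_up_last : (x.snoc p c).up (Fin.last n) = c := by
  simp [Config.snoc]

theorem Config.tower_succ : Config.tower (n + 1) p c = (Config.tower n p c).snoc p c := by
  refine Config.ext' (fun e => ?_) (fun e => ?_) <;>
    refine Fin.lastCases ?_ (fun e => ?_) e <;> simp <;> rfl

theorem Config.snoc_moveDisk_castSucc (e : Fin n) (q : Post) :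
    (x.snoc p c).moveDisk e.castSucc q = (x.moveDisk e q).snoc p c := by
  refine Config.ext' (fun f => ?_) (fun f => ?_) <;>
    refine Fin.lastCases ?_ (fun f => ?_) f <;>
    simp [Config.moveDisk, Function.update_apply, (Fin.castSucc_lt_last e).ne']

theorem Config.snoc_moveDisk_last (q : Post) :
    (x.snoc p c).moveDisk (Fin.last n) q = x.snoc q c.flip := by
  refine Config.ext' (fun f => ?_) (fun f => ?_) <;>
    refine Fin.lastCases ?_ (fun f => ?_) f <;>
    simp [Config.moveDisk]

variable {x p c}

theorem Config.snoc_injective {y : Config n} {q : Post} {c' : Color}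
    (h : x.snoc p c = y.snoc q c') : x = y ∧ p = q ∧ c = c' := by
  refine ⟨Config.ext' (fun e => ?_) (fun e => ?_), ?_, ?_⟩
  · simpa using congrArg (fun z => z.post e.castSucc) h
  · simpa using congrArg (fun z => z.up e.castSucc) h
  · simpa using congrArg (fun z => z.post (Fin.last n)) h
  · simpa using congrArg (fun z => z.up (Fin.last n)) h

theorem Config.snoc_isTop_castSucc {e : Fin n} {q : Post} :
    (x.snoc p c).IsTop e.castSucc q ↔ x.IsTop e q := by
  simp only [Config.IsTop, Fin.forall_fin_succ', Config.snoc_post_castSucc,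
    Fin.castSucc_le_castSucc_iff, and_congr_right_iff, and_iff_left_iff_imp]
  intros
  exact Fin.le_last _

theorem Config.snoc_isTop_last {q : Post} :
    (x.snoc p c).IsTop (Fin.last n) q ↔ p = q ∧ ∀ f, x.post f ≠ q := by
  simp only [Config.IsTop, Fin.forall_fin_succ', Config.snoc_post_castSucc,
    Config.snoc_post_last, and_congr_right_iff]
  rintro rfl
  simp

end Snoc

theorem plays_append {N : ℕ} {pre : PreColoring} {L₁ L₂ : List Move} {x z : Config N} :
    Plays pre (L₁ ++ L₂) x z ↔ ∃ y, Plays pre L₁ x y ∧ Plays pre L₂ y z := by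
  induction L₁ generalizing x with
  | nil => simp [Plays]
  | cons m L ih =>
    simp only [List.cons_append, Plays, ih]
    constructor
    · rintro ⟨y, h, w, h', h''⟩
      exact ⟨w, ⟨y, h, h'⟩, h''⟩
    · rintro ⟨w, ⟨y, h, h'⟩, h''⟩
      exact ⟨y, h, w, h', h''⟩

theorem plays_singleton {N : ℕ} {pre : PreColoring} {m : Move} {x y : Config N} :
    Plays pre [m] x y ↔ LegalMove pre m x y := by simp [Plays]

/-- A legal move of a small disk stays legal when a larger disk is added, because that disk acts
on the others exactly like a painted post. -/
theorem LegalMove.snoc {n : ℕ} {pre : PreColoring} {p : Post} {c : Color} (hp : Allows pre p c)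
    {m : Move} {x y : Config n} (h : LegalMove (pre.paint p c) m x y) :
    LegalMove pre m (x.snoc p c) (y.snoc p c) := by
  obtain ⟨e, h1, h2, h3, h4, h5, rfl⟩ := h
  refine ⟨e.castSucc, h1, h2, Config.snoc_isTop_castSucc.2 h3, ?_, ?_,
    (Config.snoc_moveDisk_castSucc _ _ _ _ _).symm⟩
  · intro f
    refine Fin.lastCases ?_ (fun f => ?_) f
    · rw [Config.snoc_isTop_last]
      rintro ⟨rfl, -⟩
      refine ⟨Fin.castSucc_lt_last e, ?_⟩
      have := h5 c (by simp)
      simp only [Config.snoc_up_last, Config.snoc_up_castSucc]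
      rw [← this]
      exact Color.flip_ne _
    · rw [Config.snoc_isTop_castSucc]
      intro hf
      simpa using h4 f hf
  · intro c' hc'
    rw [Config.snoc_up_castSucc]
    by_cases hq : m.dst = p
    · rw [h5 c (by simp [hq])]
      exact hp c' (hq ▸ hc')
    · exact h5 c' (by rw [PreColoring.paint_of_ne _ _ hq]; exact hc')

theorem Plays.snoc {n : ℕ} {pre : PreColoring} {p : Post} {c : Color} (hp : Allows pre p c)
    {L : List Move} {x y : Config n} (h : Plays (pre.paint p c) L x y) :
    Plays pre L (x.snoc p c) (y.snoc p c) := by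
  induction L generalizing x with
  | nil => exact congrArg (fun z => Config.snoc z p c) h
  | cons m L ih =>
    obtain ⟨z, hz, hL⟩ := h
    exact ⟨z.snoc p c, hz.snoc hp, ih hL⟩

/-- The largest disk may move when all the other disks form a tower on the third post. -/
theorem legalMove_largest {n : ℕ} {pre : PreColoring} {p q r : Post} {c e : Color} (hpq : p ≠ q)
    (hrp : r ≠ p) (hrq : r ≠ q) (hq : Allows pre q c.flip) :
    LegalMove pre ⟨n, p, q⟩ ((Config.tower n r e).snoc p c)
      ((Config.tower n r e).snoc q c.flip) := by
  refine ⟨Fin.last n, rfl, hpq, Config.snoc_isTop_last.2 ⟨rfl, fun _ => hrp⟩, ?_, ?_,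
    (Config.snoc_moveDisk_last _ _ _ _).symm⟩
  · intro f hf
    exfalso
    refine Fin.lastCases (fun hf => ?_) (fun f hf => ?_) f hf
    · exact hpq (Config.snoc_isTop_last.1 hf).1
    · exact hrq (Config.snoc_isTop_castSucc.1 hf).1
  · intro c' hc'
    simpa using hq c' hc'

/-! ### How a legal move acts on the largest disk and on the others -/

/-- An arrangement that the pre-coloring and the magnetic rule admit: on each post, all the disks
show the same color, and it is the color of the post unless the post is neutral. -/
structure Config.Fits {N : ℕ} (pre : PreColoring) (x : Config N) : Prop where
  allows : ∀ e, Allows pre (x.post e) (x.up e)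
  uniform : ∀ e f, x.post e = x.post f → x.up e = x.up f

theorem Config.fits_tower {N : ℕ} {pre : PreColoring} {p : Post} {c : Color}
    (h : Allows pre p c) : (Config.tower N p c).Fits pre := ⟨fun _ => h, fun _ _ _ => rfl⟩

theorem Config.exists_isTop {N : ℕ} (x : Config N) (e : Fin N) :
    ∃ f, x.IsTop f (x.post e) := by
  obtain ⟨f, hf, hmin⟩ := Set.exists_min_image {f | x.post f = x.post e} id (Set.toFinite _)
    ⟨e, rfl⟩
  exact ⟨f, hf, fun g hg => hmin g hg⟩

theorem LegalMove.fits {N : ℕ} {pre : PreColoring} {m : Move} {x y : Config N}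
    (h : LegalMove pre m x y) (hx : x.Fits pre) : y.Fits pre := by
  obtain ⟨e, -, h2, h3, h4, h5, rfl⟩ := h
  -- the disks already on the destination show the color that the moved disk will show
  have key : ∀ f, x.post f = m.dst → x.up f = (x.up e).flip := by
    intro f hf
    obtain ⟨g, hg⟩ := x.exists_isTop f
    rw [hx.uniform f g hg.1.symm]
    exact Color.eq_flip_of_ne (h4 g (hf ▸ hg)).2
  refine ⟨fun f => ?_, fun f g => ?_⟩
  · by_cases hf : f = e
    · subst hf
      simpa [Config.moveDisk, Allows] using fun c hc => h5 c hc
    · simpa [Config.moveDisk, hf] using hx.allows f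
  · by_cases hf : f = e <;> by_cases hg : g = e
    · simp [hf, hg]
    · subst hf
      simpa [Config.moveDisk, hg] using fun h => (key g h.symm).symm
    · subst hg
      simpa [Config.moveDisk, hf] using fun h => key f h
    · simpa [Config.moveDisk, hf, hg] using hx.uniform f g

theorem Config.Fits.of_snoc {n : ℕ} {pre : PreColoring} {x : Config n} {p : Post} {c : Color}
    (h : (x.snoc p c).Fits pre) : Allows pre p c ∧ x.Fits (pre.paint p c) := by
  have hc : ∀ e, x.post e = p → x.up e = c := fun e he => by
    simpa using h.uniform e.castSucc (Fin.last n) (by simpa using he)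
  refine ⟨by simpa using h.allows (Fin.last n), fun e => ?_, fun e f hef => ?_⟩
  · by_cases he : x.post e = p
    · intro c' hc'
      rw [he, PreColoring.paint_self, Option.some_inj] at hc'
      rw [← hc', hc e he]
    · intro c' hc'
      rw [PreColoring.paint_of_ne _ _ he] at hc'
      simpa using h.allows e.castSucc c' (by simpa using hc')
  · simpa using h.uniform e.castSucc f.castSucc (by simpa using hef)

/-- The post different from two given ones. For equal arguments, it is the next post in the cyclic
order, so that `p.third p` and `p.third (p.third p)` are the other two posts. -/
def Post.third : Post → Post → Post
  | .S, .S => .I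
  | .S, .I => .D
  | .S, .D => .I
  | .I, .S => .D
  | .I, .I => .D
  | .I, .D => .S
  | .D, .S => .I
  | .D, .I => .S
  | .D, .D => .S

theorem Post.eq_third {p q r : Post} (h : p ≠ q) (hp : r ≠ p) (hq : r ≠ q) :
    r = p.third q := by
  cases p <;> cases q <;> cases r <;> first | rfl | contradiction

/-- A legal move either moves a small disk, under the pre-coloring painted by the largest one, or
it moves the largest disk, and then the others form a tower on the third post. -/
theorem LegalMove.of_snoc {n : ℕ} {pre : PreColoring} {m : Move} {x : Config n} {p : Post}
    {c : Color} {y : Config (n + 1)} (h : LegalMove pre m (x.snoc p c) y)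
    (hx : (x.snoc p c).Fits pre) :
    (∃ z, y = z.snoc p c ∧ LegalMove (pre.paint p c) m x z) ∨
      ∃ r e, x = Config.tower n r e ∧ r ≠ p ∧ Allows (pre.paint p c) r e ∧
        Allows pre (p.third r) c.flip ∧ y = x.snoc (p.third r) c.flip := by
  have hfit := hx.of_snoc
  obtain ⟨e, h1, h2, h3, h4, h5, rfl⟩ := h
  revert h1 h3 h4 h5
  refine Fin.lastCases ?_ (fun e => ?_) e
  · intro _ h3 h4 h5
    right
    rw [Config.snoc_isTop_last] at h3
    obtain ⟨rfl, h3⟩ := h3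
    have h6 : ∀ f, x.post f ≠ m.dst := by
      intro f hf
      obtain ⟨g, hg⟩ := x.exists_isTop f
      exact absurd (h4 g.castSucc (Config.snoc_isTop_castSucc.2 (hf ▸ hg))).1
        (not_lt.2 (Fin.le_last _))
    set r := m.src.third m.dst with hr
    have hr' : m.dst = m.src.third r ∧ r ≠ m.src := by
      rw [hr]; revert h2; cases m.src <;> cases m.dst <;> simp [Post.third]
    have hpost : ∀ f, x.post f = r := fun f => Post.eq_third h2 (h3 f) (h6 f)
    have hal : Allows pre m.dst c.flip := fun c' hc' => by simpa using h5 c' hc'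
    -- without small disks, any admitted color serves for the empty tower
    obtain ⟨e, he, hup⟩ : ∃ e, Allows (pre.paint m.src c) r e ∧ ∀ f, x.up f = e := by
      rcases isEmpty_or_nonempty (Fin n) with hn | ⟨⟨f⟩⟩
      · refine ⟨(pre.paint m.src c r).getD c, fun c' hc' => ?_, fun f => (hn.false f).elim⟩
        rw [hc', Option.getD_some]
      · refine ⟨x.up f, hpost f ▸ hfit.2.allows f, fun g => ?_⟩
        exact hfit.2.uniform g f (by rw [hpost, hpost])
    refine ⟨r, e, Config.ext' hpost hup, hr'.2, he, hr'.1 ▸ hal, ?_⟩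
    rw [Config.snoc_moveDisk_last, ← hr'.1]
  · intro h1 h3 h4 h5
    left
    refine ⟨x.moveDisk e m.dst, Config.snoc_moveDisk_castSucc _ _ _ _ _, e, h1, h2,
      Config.snoc_isTop_castSucc.1 h3, fun f hf => ?_, fun c' hc' => ?_, rfl⟩
    · simpa using h4 f.castSucc (Config.snoc_isTop_castSucc.2 hf)
    · by_cases hq : m.dst = p
      · rw [hq, PreColoring.paint_self, Option.some_inj] at hc'
        subst hc'
        by_cases hf : ∃ f, x.post f = p
        · obtain ⟨f, hf⟩ := hf
          obtain ⟨g, hg⟩ := x.exists_isTop f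
          rw [hf] at hg
          have := h4 g.castSucc (Config.snoc_isTop_castSucc.2 (hq ▸ hg))
          have hg' := hfit.2.allows g c (by rw [hg.1]; simp)
          simp only [Config.snoc_up_castSucc, hg'] at this
          exact (Color.eq_flip_of_ne this.2).symm
        · push Not at hf
          have := h4 (Fin.last n) (Config.snoc_isTop_last.2 ⟨hq.symm, hq ▸ hf⟩)
          simp only [Config.snoc_up_castSucc, Config.snoc_up_last] at this
          exact (Color.eq_flip_of_ne this.2).symm
      · rw [PreColoring.paint_of_ne _ _ hq] at hc'
        simpa using h5 c' hc'

/-! ### The largest disk as a walk on a finite graph -/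

/-- A post together with a color: where a tower stands and which color it shows. -/
abbrev Spot := Post × Color

/-- `d` bounds from below the number of moves between towers of `n` disks, for every pre-coloring
that admits the tower at the start. -/
def IsLowerBound (n : ℕ) (d : PreColoring → Spot → Spot → ℤ) : Prop :=
  ∀ pre (s t : Spot), Allows pre s.1 s.2 → ∀ L,
    Plays pre L (Config.tower n s.1 s.2) (Config.tower n t.1 t.2) → d pre s t ≤ L.length

/-- A potential `Ψ` for the plays of `n + 1` disks under `pre` that start with a tower at `s`.
`Ψ b t` bounds from below the number of moves after which the largest disk has just reached `b`
while the others form a tower at `t`; `none` says that this never happens. Such a pair can be left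
only by taking the small tower to the post `t'.1`, at the cost `d`, and then moving the largest
disk to the third post. -/
structure IsPotential (d : PreColoring → Spot → Spot → ℤ) (pre : PreColoring) (s : Spot)
    (Ψ : Spot → Spot → Option ℤ) : Prop where
  start : Ψ s s = some 0
  step : ∀ b t k, Ψ b t = some k → Allows pre b.1 b.2 → Allows (pre.paint b.1 b.2) t.1 t.2 →
    ∀ t' : Spot, t'.1 ≠ b.1 → Allows (pre.paint b.1 b.2) t'.1 t'.2 →
      Allows pre (b.1.third t'.1) b.2.flip →
        ∃ k', Ψ (b.1.third t'.1, b.2.flip) t' = some k' ∧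
          k' ≤ k + d (pre.paint b.1 b.2) t t' + 1

theorem Plays.fits {N : ℕ} {pre : PreColoring} {L : List Move} {x y : Config N}
    (h : Plays pre L x y) (hx : x.Fits pre) : y.Fits pre := by
  induction L generalizing x with
  | nil => exact h ▸ hx
  | cons m L ih =>
    obtain ⟨z, hz, hL⟩ := h
    exact ih hL (hz.fits hx)

theorem Config.exists_snoc {n : ℕ} (y : Config (n + 1)) : ∃ z p c, y = Config.snoc (n := n) z p c :=
  ⟨⟨fun e => y.post e.castSucc, fun e => y.up e.castSucc⟩, y.post (Fin.last n), y.up (Fin.last n),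
    Config.ext' (fun e => by refine Fin.lastCases ?_ (fun e => ?_) e <;> simp)
      (fun e => by refine Fin.lastCases ?_ (fun e => ?_) e <;> simp)⟩

/-- A play of `n + 1` disks splits at the last move of the largest disk: up to there the potential
is a lower bound, and from there on only the small disks move. -/
theorem IsPotential.le_length {n : ℕ} {d : PreColoring → Spot → Spot → ℤ} (hd : IsLowerBound n d)
    {pre : PreColoring} {s : Spot} (hs : Allows pre s.1 s.2) {Ψ : Spot → Spot → Option ℤ}
    (hΨ : IsPotential d pre s Ψ) (L : List Move) :
    ∀ (z : Config n) (b : Spot),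
      Plays pre L (Config.tower (n + 1) s.1 s.2) (z.snoc b.1 b.2) →
        ∃ t k L', Ψ b t = some k ∧ Allows (pre.paint b.1 b.2) t.1 t.2 ∧
          Plays (pre.paint b.1 b.2) L' (Config.tower n t.1 t.2) z ∧ k + L'.length ≤ L.length := by
  induction L using List.reverseRecOn with
  | nil =>
    intro z b h
    rw [Plays, Config.tower_succ] at h
    obtain ⟨h1, h2, h3⟩ := Config.snoc_injective h
    obtain rfl : s = b := Prod.ext h2 h3
    exact ⟨s, 0, [], hΨ.start, fun c hc => by simpa using hc, h1, by simp⟩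
  | append_singleton L m ih =>
    intro z b h
    obtain ⟨y, hL, hm⟩ := plays_append.1 h
    rw [plays_singleton] at hm
    obtain ⟨x, p, c, rfl⟩ := y.exists_snoc
    have hfit := hL.fits (Config.fits_tower hs)
    obtain ⟨t, k, L', hk, ht, hL', hlen⟩ := ih x (p, c) hL
    rcases hm.of_snoc hfit with ⟨z', hz', hm'⟩ | ⟨r, e, rfl, hr, he, hal, hy⟩
    · obtain ⟨rfl, h2, h3⟩ := Config.snoc_injective hz'
      obtain rfl : b = (p, c) := Prod.ext h2 h3
      refine ⟨t, k, L' ++ [m], hk, ht, plays_append.2 ⟨x, hL', plays_singleton.2 hm'⟩, ?_⟩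
      push_cast [List.length_append, List.length_singleton]
      linarith
    · obtain ⟨rfl, h2, h3⟩ := Config.snoc_injective hy
      obtain rfl : b = (p.third r, c.flip) := Prod.ext h2 h3
      obtain ⟨k', hk', hle⟩ := hΨ.step (p, c) t k hk hfit.of_snoc.1 ht (r, e) hr he hal
      refine ⟨(r, e), k', [], hk', fun c' hc' => ?_, rfl, ?_⟩
      · have : r ≠ p.third r := by revert hr; cases p <;> cases r <;> simp [Post.third]
        rw [PreColoring.paint_of_ne _ _ this] at hc'
        exact he c' (by rw [PreColoring.paint_of_ne _ _ hr]; exact hc')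
      · have := hd _ t (r, e) ht L' hL'
        push_cast [List.length_append, List.length_singleton, List.length_nil]
        simp only at this hle
        linarith

theorem IsPotential.le_length_tower {n : ℕ} {d : PreColoring → Spot → Spot → ℤ}
    (hd : IsLowerBound n d) {pre : PreColoring} {s t : Spot} (hs : Allows pre s.1 s.2)
    {Ψ : Spot → Spot → Option ℤ} (hΨ : IsPotential d pre s Ψ) {B : ℤ}
    (hB : ∀ t' k, Ψ t t' = some k → Allows (pre.paint t.1 t.2) t'.1 t'.2 →
      B ≤ k + d (pre.paint t.1 t.2) t' t) {L : List Move}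
    (hL : Plays pre L (Config.tower (n + 1) s.1 s.2) (Config.tower (n + 1) t.1 t.2)) :
    B ≤ L.length := by
  rw [Config.tower_succ t.1] at hL
  obtain ⟨t', k, L', hk, ht', hL', hlen⟩ := hΨ.le_length hd hs L _ _ hL
  have := hd _ t' t ht' L' hL'
  linarith [hB t' k hk ht']

/-! ### Linear forms in the savings -/

/-- The total weight of the moves of `SRBB1000 n` when a move of disk `j` has weight `w j`. -/
def full (w : ℕ → ℕ) : ℕ → ℕ
  | 0 => 0
  | n + 1 => 3 * full w n + w n

/-- The weight that `SRBN909 n` saves against `SRBB1000 n`. The savings of the other procedures are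
sums of consecutive terms. -/
def saved (w : ℕ → ℕ) : ℕ → ℕ
  | 0 => 0
  | 1 => 0
  | 2 => 0
  | n + 3 => saved w (n + 1) + 2 * saved w n + 2 * full w n

/-- The linear form `a * full 1 m + x * saved 1 m + y * saved 1 (m + 1) + z * saved 1 (m + 2) + k`
in the sequences that count moves. -/
structure Form where
  a : ℤ
  x : ℤ
  y : ℤ
  z : ℤ
  k : ℤ

namespace Form

/-- The value of the form at `m`, which stands for `m + 1` disks. -/
def eval (f : Form) (m : ℕ) : ℤ :=
  f.a * full 1 m + f.x * saved 1 m + f.y * saved 1 (m + 1) + f.z * saved 1 (m + 2) + f.k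

/-- The constant form. -/
def const (k : ℤ) : Form := ⟨0, 0, 0, 0, k⟩

/-- The sum of two forms. -/
def add (f g : Form) : Form := ⟨f.a + g.a, f.x + g.x, f.y + g.y, f.z + g.z, f.k + g.k⟩

/-- The form whose value at `m` is the value of `f` at `m + 1`. -/
def next (f : Form) : Form := ⟨3 * f.a + 2 * f.z, 2 * f.z, f.x + f.z, f.y, f.k + f.a⟩

/-- A sufficient condition for `f.eval m ≤ g.eval m`, by Abel summation along
`full 1 m ≥ saved 1 (m + 2) ≥ saved 1 (m + 1) ≥ saved 1 m ≥ 0`. -/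
def Le (f g : Form) : Prop :=
  f.a ≤ g.a ∧ f.a + f.z ≤ g.a + g.z ∧ f.a + f.z + f.y ≤ g.a + g.z + g.y ∧
    f.a + f.z + f.y + f.x ≤ g.a + g.z + g.y + g.x ∧ f.k ≤ g.k

instance (f g : Form) : Decidable (f.Le g) := by unfold Le; infer_instance

@[simp] theorem eval_const (k : ℤ) (m : ℕ) : (const k).eval m = k := by simp [eval, const]

@[simp] theorem eval_add (f g : Form) (m : ℕ) : (f.add g).eval m = f.eval m + g.eval m := by
  simp only [eval, add]; ring

theorem eval_next (f : Form) (m : ℕ) : f.next.eval m = f.eval (m + 1) := by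
  simp only [eval, next, full, saved, Pi.one_apply]; push_cast; ring

end Form

/-- The summand `2 * saved 1 m` in the second inequality makes the third one inductive. -/
theorem saved_growth (m : ℕ) :
    saved 1 m ≤ saved 1 (m + 1) ∧ saved 1 (m + 1) + 2 * saved 1 m ≤ saved 1 (m + 2) ∧
      saved 1 (m + 2) ≤ full 1 m := by
  induction m with
  | zero => simp [saved, full]
  | succ m ih =>
    have h1 : saved 1 (m + 3) = saved 1 (m + 1) + 2 * saved 1 m + 2 * full 1 m := rfl
    have h2 : full 1 (m + 1) = 3 * full 1 m + 1 := rfl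
    show saved 1 (m + 1) ≤ saved 1 (m + 2) ∧
      saved 1 (m + 2) + 2 * saved 1 (m + 1) ≤ saved 1 (m + 3) ∧ saved 1 (m + 3) ≤ full 1 (m + 1)
    omega

theorem Form.Le.eval_le {f g : Form} (h : f.Le g) (m : ℕ) : f.eval m ≤ g.eval m := by
  obtain ⟨h1, h2, h3, h4, h5⟩ := h
  obtain ⟨s1, s2, s3⟩ := saved_growth m
  have p0 : (0 : ℤ) ≤ saved 1 m := by positivity
  have p1 : (0 : ℤ) ≤ saved 1 (m + 1) - saved 1 m := by omega
  have p2 : (0 : ℤ) ≤ saved 1 (m + 2) - saved 1 (m + 1) := by omega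
  have p3 : (0 : ℤ) ≤ full 1 m - saved 1 (m + 2) := by omega
  have := mul_nonneg (sub_nonneg.2 h1) p3
  have := mul_nonneg (sub_nonneg.2 h2) p2
  have := mul_nonneg (sub_nonneg.2 h3) p1
  have := mul_nonneg (sub_nonneg.2 h4) p0
  simp only [eval]
  linarith

/-! ### The table of lower bounds -/

/-- The lower bound for the number of moves between two towers of `m + 1` disks, as a form in `m`.
It is `0` for equal towers, for pairs of towers that no play connects, and for those pairs under
three neutral posts that the induction does not need. It is the exact distance in all other cases
but one: between two neutral posts, with both towers showing the color of the third post, a weaker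
bound suffices. Only pre-colorings that admit both towers matter. -/
def bound (pre : PreColoring) (s t : Spot) : Form :=
  if s.1 = t.1 then
    if s.2 = t.2 then .const 0
    -- the tower is turned over on its post, which is neutral
    else match pre (s.1.third s.1), pre (s.1.third (s.1.third s.1)) with
      | none, none => .const 0
      | some a, some b => if a = b then .const 0 else ⟨7, 0, 0, -1, 3⟩
      | _, _ => ⟨5, -3, 0, 0, 3⟩
  else match pre s.1, pre t.1, pre (s.1.third t.1) with
    -- `SRBB1000`, or two of its runs over the third post
    | some a, some b, some e =>
      if a = b then (if e = a then .const 0 else ⟨6, 0, 0, 0, 2⟩) else ⟨3, 0, 0, 0, 1⟩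
    -- two runs of `SRBB1000`, or `SRNB727`
    | some a, some b, none => if a = b then ⟨6, 0, 0, 0, 2⟩ else ⟨3, 0, 0, -1, 1⟩
    -- for different colors, `SRBB1000` or `SRBN909`
    | some a, none, some e | none, some a, some e =>
      if e = a then (if s.2 = t.2 then .const 0 else ⟨3, 0, 0, 0, 1⟩)
      else (if s.2 = t.2 then ⟨4, -2, 0, 0, 2⟩ else ⟨3, 0, -1, 0, 1⟩)
    -- for equal colors `moveAllButNDown606` or its reversal, otherwise `SRNN636` or its reversal
    | some _, none, none | none, some _, none =>
      if s.2 = t.2 then ⟨4, -2, -1, 0, 2⟩ else ⟨3, 0, -1, -1, 1⟩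
    -- for different colors, `SRBN909`
    | none, none, some e =>
      if s.2 = t.2 then (if s.2 = e then ⟨6, 0, 0, 0, 2⟩ else ⟨4, -1, 0, -1, 2⟩)
      else ⟨3, 0, -1, 0, 1⟩
    -- `solveUp606`
    | none, none, none => if s.2 = t.2 then .const 0 else ⟨3, -1, -1, -1, 1⟩

/-! ### The potential and its verification -/

/-- Quantifiers over posts, colors and colors of posts are decided by plain case distinctions, which
the kernel evaluates faster than enumerations of finite types. -/
instance decidableForallPost {P : Post → Prop} [DecidablePred P] : Decidable (∀ p, P p) :=
  decidable_of_iff (P .S ∧ P .I ∧ P .D)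
    ⟨fun h p => by cases p <;> simp [h], fun h => ⟨h _, h _, h _⟩⟩

instance decidableForallColor {P : Color → Prop} [DecidablePred P] : Decidable (∀ c, P c) :=
  decidable_of_iff (P .red ∧ P .blue)
    ⟨fun h c => by cases c <;> simp [h], fun h => ⟨h _, h _⟩⟩

instance (pre : PreColoring) (p : Post) (c : Color) : Decidable (Allows pre p c) := by
  unfold Allows; infer_instance

section Potential

variable (F : PreColoring → Spot → Spot → Form) (far : Form) (pre : PreColoring) (s : Spot)

/-- Lower bound for the plays in which the largest disk moves twice, from `s.1` over a post `y` to
`x`, while the small tower goes from `s` to `x` and then back to `s.1`, where it shows `e`. -/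
def twoMoves (x : Post) (e : Color) : Option Form :=
  let y := s.1.third x
  if Allows pre y s.2.flip ∧ Allows pre x s.2 then
    -- the cheaper color for the small tower on `x`
    let u : Spot := (x, (pre x).getD e.flip)
    some (((F (pre.paint s.1 s.2) s u).add (F (pre.paint y s.2.flip) u (s.1, e))).add (.const 2))
  else none

/-- Lower bound for the plays in which the largest disk goes around once and comes back to `s.1`
turned over, while the small tower ends at `t`. The first move goes to the post `t.1`; if its color
rules that out, more than three moves are needed, and `far` is the bound. -/
def aroundMoves (t : Spot) : Option Form :=
  let y := s.1.third t.1
  if pre s.1 = none then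
    if Allows pre y s.2 ∧ Allows pre t.1 s.2.flip then
      -- the cheaper color for the small tower on `s.1`, before the last move of the largest disk
      let u : Spot := (s.1, if pre y = none then t.2.flip else s.2.flip)
      (twoMoves F pre s y u.2).map fun f => (f.add (F (pre.paint y s.2) u t)).add (.const 1)
    else if pre t.1 = some s.2 ∧ pre y = none then some far
    else none
  else none

/-- The potential for the plays that start with a tower at `s`; see `IsPotential`. Once the small
tower is at `t`, the largest disk can go back and forth between the other two posts, which accounts
for the summands `1` and `2`. -/
def potential (b t : Spot) : Option Form :=
  if b = s ∧ t = s then some (.const 0)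
  else if b.1 = t.1 then none
  else if t.1 = s.1 then
    if b.2 = s.2 then twoMoves F pre s b.1 t.2
    else (twoMoves F pre s (s.1.third b.1) t.2).map fun f => f.add (.const 1)
  else if b.1 = s.1 then
    if b.2 = s.2 then
      if Allows pre (s.1.third t.1) s.2.flip then
        some ((F (pre.paint s.1 s.2) s t).add (.const 2))
      else none
    else aroundMoves F far pre s t
  else
    if b.2 = s.2 then (aroundMoves F far pre s t).map fun f => f.add (.const 1)
    else some ((F (pre.paint s.1 s.2) s t).add (.const 1))

/-- The inequalities that make `F'` a table of lower bounds for one more disk than `F`, for plays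
that start with a tower at `s`: the potential increases along each step of the largest disk at most
by the cost of the step, and `F'` does not exceed the potential plus the cost of completing the
tower. -/
def Closed (F' : PreColoring → Spot → Spot → Form) : Prop :=
  (∀ (p : Post) (c : Color), Allows pre p c →
    ∀ (q : Post) (e : Color), Allows (pre.paint p c) q e →
      ∀ f ∈ potential F far pre s (p, c) (q, e),
        (F' pre s (p, c)).Le (f.add (F (pre.paint p c) (q, e) (p, c))) ∧
        ∀ r, r ≠ p → Allows pre (p.third r) c.flip →
          ∀ e', Allows (pre.paint p c) r e' →
            ∃ f' ∈ potential F far pre s (p.third r, c.flip) (r, e'),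
              f'.Le ((f.add (F (pre.paint p c) (q, e) (r, e'))).add (.const 1)))

instance (F' : PreColoring → Spot → Spot → Form) : Decidable (Closed F far pre s F') := by
  unfold Closed; infer_instance

end Potential

/-- The pre-coloring with the given colors of `S`, `I`, `D`. -/
def PreColoring.mk (x y z : Option Color) : PreColoring
  | .S => x
  | .I => y
  | .D => z

instance decidableForallOptionColor {P : Option Color → Prop} [DecidablePred P] :
    Decidable (∀ c, P c) :=
  decidable_of_iff (P none ∧ P (some .red) ∧ P (some .blue))
    ⟨fun h c => by rcases c with _ | c; exacts [h.1, by cases c <;> simp [h]],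
      fun h => ⟨h _, h _, h _⟩⟩

/-- The table `bound` reproduces itself when a disk is added. As `far`, the new entry for turning a
tower over, with one neutral and one colored post besides its own, is large enough. -/
theorem closed_bound : ∀ x y z p c, Allows (.mk x y z) p c →
    Closed bound ⟨15, 0, -3, 0, 8⟩ (.mk x y z) (p, c) (fun pre s t => (bound pre s t).next) := by
  decide +kernel

/-- The case of a single disk, from the table `0` for no disks. The sequences vanish at `0`, so only
the constant terms of `bound` count. -/
theorem closed_zero : ∀ x y z p c, Allows (.mk x y z) p c →
    Closed (fun _ _ _ => .const 0) (.const 3) (.mk x y z) (p, c)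
      (fun pre s t => .const (bound pre s t).k) := by
  decide +kernel

theorem PreColoring.eq_mk (pre : PreColoring) : pre = .mk (pre .S) (pre .I) (pre .D) := by
  funext p; cases p <;> rfl

theorem Closed.isLowerBound {n m : ℕ} {F F' : PreColoring → Spot → Spot → Form} {far : Form}
    (hF : IsLowerBound n fun pre s t => (F pre s t).eval m)
    (h : ∀ x y z p c, Allows (.mk x y z) p c → Closed F far (.mk x y z) (p, c) F') :
    IsLowerBound (n + 1) fun pre s t => (F' pre s t).eval m := by
  rintro pre s ⟨tp, tc⟩ hs L hL
  have hc : Closed F far pre s F' := by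
    rw [pre.eq_mk] at hs ⊢
    exact h _ _ _ _ _ hs
  have ht : Allows pre tp tc := by
    have := (hL.fits (Config.fits_tower hs)).allows (Fin.last n)
    exact this
  refine IsPotential.le_length_tower hF hs
    (Ψ := fun b t => (potential F far pre s b t).map fun f => f.eval m) ⟨?_, ?_⟩ ?_ hL
  · simp [potential]
  · rintro ⟨p, c⟩ ⟨q, e⟩ k hk hb ht ⟨r, e'⟩ hr hr' hal
    obtain ⟨f, hf, rfl⟩ := Option.map_eq_some_iff.1 hk
    obtain ⟨f', hf', hle⟩ := (hc p c hb q e ht f hf).2 r hr hal e' hr'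
    refine ⟨_, Option.map_eq_some_iff.2 ⟨f', hf', rfl⟩, ?_⟩
    simpa using hle.eval_le m
  · rintro ⟨q, e⟩ k hk hq
    obtain ⟨f, hf, rfl⟩ := Option.map_eq_some_iff.1 hk
    simpa using (hc tp tc ht q e hq f hf).1.eval_le m

theorem isLowerBound_bound (m : ℕ) :
    IsLowerBound (m + 1) fun pre s t => (bound pre s t).eval m := by
  induction m with
  | zero =>
    have h0 : IsLowerBound 0 fun pre s t => (Form.const 0).eval 0 := fun _ _ _ _ L _ => by simp
    have := Closed.isLowerBound h0 closed_zero
    simpa [Form.eval, Form.const, full, saved] using this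
  | succ m ih =>
    have := Closed.isLowerBound ih closed_bound
    simpa only [Form.eval_next] using this

theorem le_length_of_solves {m : ℕ} {L : List Move} (h : Solves free (m + 1) L) :
    full 1 (m + 1) ≤ L.length + saved 1 m + saved 1 (m + 1) + saved 1 (m + 2) := by
  have := isLowerBound_bound m free (.S, .red) (.D, .blue) (fun c hc => by simp [free] at hc) L h
  simp only [bound, free, Form.eval, full, Pi.one_apply] at this ⊢
  push_cast at this
  simp at this
  omega

/-! ### The procedures play from tower to tower -/

theorem Plays.append {N : ℕ} {pre : PreColoring} {L₁ L₂ : List Move} {x y z : Config N}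
    (h₁ : Plays pre L₁ x y) (h₂ : Plays pre L₂ y z) : Plays pre (L₁ ++ L₂) x z :=
  plays_append.2 ⟨y, h₁, h₂⟩

theorem allows_of_none {pre : PreColoring} {p : Post} {c : Color} (h : pre p = none) :
    Allows pre p c := fun c' hc' => by rw [h] at hc'; cases hc'

theorem allows_paint {pre : PreColoring} {p q : Post} {c e : Color} :
    Allows (pre.paint p c) q e ↔ if q = p then e = c else Allows pre q e := by
  split_ifs with h
  · subst h; simp [Allows]
  · simp [Allows, PreColoring.paint_of_ne _ _ h]

theorem paint_eq_none {pre : PreColoring} {p q : Post} {c : Color} :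
    pre.paint p c q = none ↔ q ≠ p ∧ pre q = none := by
  by_cases h : q = p
  · subst h; simp
  · simp [h, PreColoring.paint_of_ne _ _ h]

theorem plays_largest {n : ℕ} {pre : PreColoring} {p q r : Post} {c e k : Color}
    (hk : k = c.flip) (hpq : p ≠ q) (hrp : r ≠ p) (hrq : r ≠ q) (hq : Allows pre q k) :
    Plays pre [⟨n, p, q⟩] ((Config.tower n r e).snoc p c) ((Config.tower n r e).snoc q k) := by
  subst hk
  exact plays_singleton.2 (legalMove_largest hpq hrp hrq hq)

/-- Whenever the three posts satisfy the requirement `R pre s d i c`, the procedure `L`, called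
with `s d i`, takes the tower of `n` disks from `s`, showing `c`, to `d`, turned over. -/
def Transports (R : PreColoring → Post → Post → Post → Color → Prop) (n : ℕ)
    (L : Post → Post → Post → List Move) : Prop :=
  ∀ (s d i : Post) (c k : Color) (pre : PreColoring), k = c.flip → s ≠ d → i ≠ s → i ≠ d →
    R pre s d i c → Plays pre (L s d i) (Config.tower n s c) (Config.tower n d k)

/-- Requirement of `SRBB1000`. Neutral posts are admitted: they never receive a wrong color. -/
def ReqRBB (pre : PreColoring) (s d i : Post) (c : Color) : Prop :=
  Allows pre s c ∧ Allows pre i c.flip ∧ Allows pre d c.flip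

/-- Requirement of `SRRB1000`. -/
def ReqRRB (pre : PreColoring) (s d i : Post) (c : Color) : Prop :=
  Allows pre s c ∧ Allows pre i c ∧ Allows pre d c.flip

/-- Requirement of `SRBN909`. Its subprocedures bring towers of both colors to the destination,
which therefore has to be neutral. -/
def ReqRBN (pre : PreColoring) (s d i : Post) (c : Color) : Prop :=
  Allows pre s c ∧ Allows pre i c.flip ∧ pre d = none

/-- Requirement of `SNRB909`. -/
def ReqNRB (pre : PreColoring) (s d i : Post) (c : Color) : Prop :=
  pre s = none ∧ Allows pre i c ∧ Allows pre d c.flip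

/-- Requirement of `SRNB727` and of `SBNR727`. -/
def ReqRNB (pre : PreColoring) (s d i : Post) (c : Color) : Prop :=
  Allows pre s c ∧ pre i = none ∧ Allows pre d c.flip

/-- Requirement of `SRNN636`. -/
def ReqRNN (pre : PreColoring) (s d i : Post) (c : Color) : Prop :=
  Allows pre s c ∧ pre i = none ∧ pre d = none

/-- Requirement of `SNNB636`. -/
def ReqNNB (pre : PreColoring) (s d i : Post) (c : Color) : Prop :=
  pre s = none ∧ pre i = none ∧ Allows pre d c.flip

theorem transports_zero (R : PreColoring → Post → Post → Post → Color → Prop)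
    {L : Post → Post → Post → List Move} (h : ∀ s d i, L s d i = []) : Transports R 0 L := by
  intro s d i c k pre _ _ _ _ _
  rw [h]
  exact Subsingleton.elim _ _

theorem transports_RBB_RRB (n : ℕ) :
    Transports ReqRBB n (SRBB1000 n) ∧ Transports ReqRRB n (SRRB1000 n) := by
  induction n with
  | zero => exact ⟨transports_zero _ fun _ _ _ => rfl, transports_zero _ fun _ _ _ => rfl⟩
  | succ n ih =>
    obtain ⟨ih₁, ih₂⟩ := ih
    constructor <;> rintro s d i c k pre hk hsd his hid ⟨h1, h2, h3⟩ <;>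
      have hds := hsd.symm <;> have hsi := his.symm <;> have hdi := hid.symm <;>
      have hk' : c = k.flip := by simp [hk]
    · rw [← hk] at h2 h3
      simp only [SRBB1000, List.append_assoc, Config.tower_succ]
      refine .append (.snoc h1 (ih₁ s i d c k _ hk hsi hds hdi ?_))
        (.append (plays_largest hk hsd his hid h3)
          (.append (.snoc h3 (ih₂ i s d k c _ hk' his hdi hds ?_))
            (.snoc h3 (ih₁ s d i c k _ hk hsd his hid ?_)))) <;>
        (clear hk'; subst hk; simp [ReqRBB, ReqRRB, allows_paint, *])
    · rw [← hk] at h3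
      simp only [SRRB1000, List.append_assoc, Config.tower_succ]
      refine .append (.snoc h1 (ih₂ s d i c k _ hk hsd his hid ?_))
        (.append (.snoc h1 (ih₁ d i s k c _ hk' hdi hsd hsi ?_))
          (.append (plays_largest hk hsd his hid h3)
            (.snoc h3 (ih₂ i d s c k _ hk hid hsi hsd ?_)))) <;>
        (clear hk'; subst hk; simp [ReqRBB, ReqRRB, allows_paint, *])

/-- A detour over `s` takes the tower from `i` to `d` without a change of color. -/
theorem plays_detour {n : ℕ} {pre : PreColoring} {s d i : Post} {c k : Color} (hk : k = c.flip)
    (hsd : s ≠ d) (his : i ≠ s) (hid : i ≠ d) (hi : Allows pre i c) (hs : Allows pre s k)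
    (hd : Allows pre d c) :
    Plays pre (SRRB1000 n i s d ++ SRBB1000 n s d i) (Config.tower n i c)
      (Config.tower n d c) := by
  have hk' : c = k.flip := by simp [hk]
  refine .append ((transports_RBB_RRB n).2 i s d c k _ hk his hid.symm hsd.symm ?_)
    ((transports_RBB_RRB n).1 s d i k c _ hk' hsd his hid ?_) <;>
    (clear hk'; subst hk; simp [ReqRBB, ReqRRB, *])

/-- The last part of `SRNB727` and of `SRNN636`. -/
theorem plays_second_half {n : ℕ} (h₁ : Transports ReqRBN n (SRBN909 n))
    (h₂ : Transports ReqNRB n (SNRB909 n)) {pre : PreColoring} {s d i : Post} {c k : Color}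
    (hk : k = c.flip) (hsd : s ≠ d) (his : i ≠ s) (hid : i ≠ d) (hs : Allows pre s c)
    (hi : pre i = none) (hd : Allows pre d k) :
    Plays pre (SRRB1000 n i s d ++ (SRBB1000 n s d i ++ ([⟨n, i, s⟩] ++ (SRBN909 n d i s ++
      ([⟨n, s, d⟩] ++ SNRB909 n i d s))))) (Config.tower (n + 1) i k)
      (Config.tower (n + 1) d k) := by
  have hds := hsd.symm
  have hsi := his.symm
  have hdi := hid.symm
  have hk' : c = k.flip := by simp [hk]
  have hi' : Allows pre i k := allows_of_none hi
  simp only [Config.tower_succ]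
  rw [← List.append_assoc]
  refine .append (y := (Config.tower n d k).snoc i k) (.snoc hi' ?_)
    (.append (plays_largest hk' his hdi hds hs)
      (.append (.snoc hs (h₁ d i s k c _ hk' hdi hsd hsi ?_))
        (.append (plays_largest hk hsd his hid hd)
          (.snoc hd (h₂ i d s c k _ hk hid hsi hsd ?_)))))
  · exact plays_detour hk' hsd his hid (by simp [allows_paint])
      (by simp [allows_paint, hsi, hs]) (by simp [allows_paint, hdi, hd])
  all_goals
    clear hk'; subst hk; simp [ReqRBN, ReqNRB, allows_paint, paint_eq_none, *]

/-- The first part of `SBNR727` and of `SNNB636`. -/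
theorem plays_first_half {n : ℕ} (h₁ : Transports ReqRBN n (SRBN909 n))
    (h₂ : Transports ReqNRB n (SNRB909 n)) {pre : PreColoring} {s d i : Post} {c k : Color}
    (hk : k = c.flip) (hsd : s ≠ d) (his : i ≠ s) (hid : i ≠ d) (hs : Allows pre s c)
    (hi : pre i = none) (hd : Allows pre d k) :
    Plays pre (SRBN909 n s i d ++ ([⟨n, s, d⟩] ++ (SNRB909 n i s d ++ ([⟨n, d, i⟩] ++
      (SRRB1000 n s d i ++ SRBB1000 n d i s))))) (Config.tower (n + 1) s c)
      (Config.tower (n + 1) i c) := by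
  have hds := hsd.symm
  have hsi := his.symm
  have hdi := hid.symm
  have hk' : c = k.flip := by simp [hk]
  have hi' : Allows pre i c := allows_of_none hi
  rw [Config.tower_succ, Config.tower_succ]
  refine .append (.snoc hs (h₁ s i d c k _ hk hsi hds hdi ?_))
    (.append (plays_largest hk hsd his hid hd)
      (.append (.snoc hd (h₂ i s d k c _ hk' his hdi hds ?_))
        (.append (plays_largest hk' hdi hsd hsi hi') ?_)))
  rotate_left 2
  · exact .snoc hi' (plays_detour hk hdi hsd hsi (by simp [allows_paint, hsi, hs])
      (by simp [allows_paint, hdi, hd]) (by simp [allows_paint]))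
  all_goals
    clear hk'; subst hk; simp [ReqRBN, ReqNRB, allows_paint, paint_eq_none, *]

theorem plays_largest_of_zero {pre : PreColoring} {p q r : Post} {c k : Color} {x y : Config 0}
    (hk : k = c.flip) (hpq : p ≠ q) (hrp : r ≠ p) (hrq : r ≠ q) (hq : Allows pre q k) :
    Plays pre [⟨0, p, q⟩] (x.snoc p c) (y.snoc q k) := by
  rw [Subsingleton.elim x (Config.tower 0 r c), Subsingleton.elim y (Config.tower 0 r c)]
  exact plays_largest hk hpq hrp hrq hq

theorem transports_909_727 (n : ℕ) :
    (Transports ReqRBN n (SRBN909 n) ∧ Transports ReqNRB n (SNRB909 n)) ∧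
      Transports ReqRNB n (SRNB727 n) ∧ Transports ReqRNB n (SBNR727 n) := by
  induction n using Nat.strong_induction_on with
  | _ n ih =>
  have h909 : Transports ReqRBN n (SRBN909 n) ∧ Transports ReqNRB n (SNRB909 n) := by
    rcases n with _ | n
    · exact ⟨transports_zero _ fun _ _ _ => by simp [SRBN909],
        transports_zero _ fun _ _ _ => by simp [SNRB909]⟩
    obtain ⟨-, ih₁, ih₂⟩ := ih n (Nat.lt_succ_self n)
    constructor <;> rintro s d i c k pre hk hsd his hid ⟨h1, h2, h3⟩ <;>
      have hds := hsd.symm <;> have hsi := his.symm <;> have hdi := hid.symm <;>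
      have hk' : c = k.flip := by simp [hk]
    · have h3' : Allows pre d k := allows_of_none h3
      rw [← hk] at h2
      simp only [SRBN909, List.append_assoc, Config.tower_succ]
      refine .append (.snoc h1 (ih₁ s i d c k _ hk hsi hds hdi ?_))
        (.append (plays_largest hk hsd his hid h3') (.snoc h3' (plays_detour hk' hsd his hid
          (by simp [allows_paint, hid, h2]) (by simp [allows_paint, hsd, h1])
          (by simp [allows_paint]))))
      clear hk'; subst hk; simp [ReqRNB, allows_paint, paint_eq_none, *]
    · have h1' : Allows pre s c := allows_of_none h1
      rw [← hk] at h3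
      simp only [SNRB909, List.append_assoc, Config.tower_succ]
      rw [← List.append_assoc]
      refine .append (.snoc h1' (plays_detour hk hdi hsd hsi (by simp [allows_paint])
        (by simp [allows_paint, hds, h3]) (by simp [allows_paint, his, h2])))
        (.append (plays_largest hk hsd his hid h3) (.snoc h3 (ih₂ i d s c k _ hk hid hsi hsd ?_)))
      clear hk'; subst hk; simp [ReqRNB, allows_paint, paint_eq_none, *]
  refine ⟨h909, ?_⟩
  rcases n with _ | _ | n
  · exact ⟨transports_zero _ fun _ _ _ => by simp [SRNB727],
      transports_zero _ fun _ _ _ => by simp [SBNR727]⟩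
  · constructor <;> rintro s d i c k pre hk hsd his hid ⟨h1, h2, h3⟩
    · simp only [SRNB727, Config.tower_succ]
      exact plays_largest_of_zero hk hsd his hid (hk ▸ h3)
    · simp only [SBNR727, Config.tower_succ]
      exact plays_largest_of_zero hk hsd his hid (hk ▸ h3)
  obtain ⟨⟨ih₁, ih₂⟩, -⟩ := ih n (by omega)
  obtain ⟨⟨ih₃, ih₄⟩, -⟩ := ih (n + 1) (by omega)
  constructor <;> rintro s d i c k pre hk hsd his hid ⟨h1, h2, h3⟩ <;>
    have hds := hsd.symm <;> have hsi := his.symm <;> have hdi := hid.symm <;>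
    rw [← hk] at h3
  · simp only [SRNB727, List.append_assoc]
    rw [Config.tower_succ (n := n + 1) s, Config.tower_succ (n := n + 1) d]
    refine .append (.snoc h1 (ih₃ s i d c k _ hk hsi hds hdi ?_))
      (.append (plays_largest hk hsd his hid h3) (.snoc h3 (plays_second_half ih₁ ih₂ hk hsd his
        hid (by simp [allows_paint, hsd, h1]) (by simp [paint_eq_none, hid, h2])
        (by simp [allows_paint]))))
    subst hk; simp [ReqRBN, allows_paint, paint_eq_none, *]
  · have h2' : Allows pre i c := allows_of_none h2
    simp only [SBNR727, List.append_assoc]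
    rw [Config.tower_succ (n := n + 1) s, Config.tower_succ (n := n + 1) d]
    simp only [← List.append_assoc]
    rw [List.append_assoc]
    refine .append (.snoc h1 ?_)
      (.append (plays_largest hk hsd his hid h3) (.snoc h3 (ih₄ i d s c k _ hk hid hsi hsd ?_)))
    · simpa only [List.append_assoc] using plays_first_half ih₁ ih₂ hk hsd his hid
        (pre := pre.paint s c) (by simp [allows_paint]) (by simp [paint_eq_none, his, h2])
        (by simp [allows_paint, hds, h3])
    · subst hk; simp [ReqNRB, allows_paint, paint_eq_none, *]

theorem transports_RNN_NNB (n : ℕ) :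
    Transports ReqRNN n (SRNN636 n) ∧ Transports ReqNNB n (SNNB636 n) := by
  induction n using Nat.strong_induction_on with
  | _ n ih =>
  rcases n with _ | _ | n
  · exact ⟨transports_zero _ fun _ _ _ => by simp [SRNN636],
      transports_zero _ fun _ _ _ => by simp [SNNB636]⟩
  · constructor <;> rintro s d i c k pre hk hsd his hid ⟨h1, h2, h3⟩
    · simp only [SRNN636, Config.tower_succ]
      exact plays_largest_of_zero hk hsd his hid (allows_of_none h3)
    · simp only [SNNB636, Config.tower_succ]
      exact plays_largest_of_zero hk hsd his hid (hk ▸ h3)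
  obtain ⟨⟨ih₁, ih₂⟩, -⟩ := transports_909_727 n
  obtain ⟨ih₃, ih₄⟩ := ih (n + 1) (by omega)
  constructor <;> rintro s d i c k pre hk hsd his hid ⟨h1, h2, h3⟩ <;>
    have hds := hsd.symm <;> have hsi := his.symm <;> have hdi := hid.symm
  · have h3' : Allows pre d k := allows_of_none h3
    simp only [SRNN636, List.append_assoc]
    rw [Config.tower_succ (n := n + 1) s, Config.tower_succ (n := n + 1) d]
    refine .append (.snoc h1 (ih₃ s i d c k _ hk hsi hds hdi ?_))
      (.append (plays_largest hk hsd his hid h3') (.snoc h3' (plays_second_half ih₁ ih₂ hk hsd his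
        hid (by simp [allows_paint, hsd, h1]) (by simp [paint_eq_none, hid, h2])
        (by simp [allows_paint]))))
    subst hk; simp [ReqRNN, allows_paint, paint_eq_none, *]
  · have h1' : Allows pre s c := allows_of_none h1
    rw [← hk] at h3
    simp only [SNNB636, List.append_assoc]
    rw [Config.tower_succ (n := n + 1) s, Config.tower_succ (n := n + 1) d]
    simp only [← List.append_assoc]
    rw [List.append_assoc]
    refine .append (.snoc h1' ?_)
      (.append (plays_largest hk hsd his hid h3) (.snoc h3 (ih₄ i d s c k _ hk hid hsi hsd ?_)))
    · simpa only [List.append_assoc] using plays_first_half ih₁ ih₂ hk hsd his hid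
        (pre := pre.paint s c) (by simp [allows_paint]) (by simp [paint_eq_none, his, h2])
        (by simp [allows_paint, hds, h3])
    · subst hk; simp [ReqNNB, allows_paint, paint_eq_none, *]

/-- When only the destination is colored, `moveAllButNUp606` brings a tower there without a change
of color. -/
theorem plays_moveAllButNUp606 (n : ℕ) {s d i : Post} {c k : Color} {pre : PreColoring}
    (hk : k = c.flip) (hsd : s ≠ d) (his : i ≠ s) (hid : i ≠ d) (hs : pre s = none)
    (hi : pre i = none) (hd : Allows pre d c) :
    Plays pre (moveAllButNUp606 n s d i) (Config.tower n s c) (Config.tower n d c) := by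
  have hds := hsd.symm
  have hsi := his.symm
  have hdi := hid.symm
  have hk' : c = k.flip := by simp [hk]
  have hs' : ∀ e, Allows pre s e := fun e => allows_of_none hs
  have hi' : ∀ e, Allows pre i e := fun e => allows_of_none hi
  rcases n with _ | n
  · exact Subsingleton.elim _ _
  simp only [moveAllButNUp606, List.append_assoc, Config.tower_succ]
  rw [← List.append_assoc]
  refine .append (.snoc (hs' c) (plays_detour hk hid hsi hsd (by simp [allows_paint])
      (by simp [allows_paint, his, hi']) (by simp [allows_paint, hds, hd])))
    (.append (plays_largest hk hsi hds hdi (hi' k))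
      (.append (.snoc (hi' k) ((transports_909_727 n).1.1 d s i c k _ hk hds hid his ?_))
        (.append (plays_largest hk' hid hsi hsd hd)
          (.snoc hd ((transports_RNN_NNB n).2 s d i k c _ hk' hsd his hid ?_))))) <;>
    (clear hk'; subst hk; simp [ReqRBN, ReqNNB, allows_paint, paint_eq_none, *])

/-- When only the source is colored, `moveAllButNDown606` takes a tower away from there without a
change of color. -/
theorem plays_moveAllButNDown606 (n : ℕ) {s d i : Post} {c k : Color} {pre : PreColoring}
    (hk : k = c.flip) (hsd : s ≠ d) (his : i ≠ s) (hid : i ≠ d) (hs : Allows pre s c)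
    (hi : pre i = none) (hd : pre d = none) :
    Plays pre (moveAllButNDown606 n s d i) (Config.tower n s c) (Config.tower n d c) := by
  have hds := hsd.symm
  have hsi := his.symm
  have hdi := hid.symm
  have hk' : c = k.flip := by simp [hk]
  have hd' : ∀ e, Allows pre d e := fun e => allows_of_none hd
  have hi' : ∀ e, Allows pre i e := fun e => allows_of_none hi
  rcases n with _ | n
  · exact Subsingleton.elim _ _
  simp only [moveAllButNDown606, List.append_assoc, Config.tower_succ]
  refine .append (.snoc hs ((transports_RNN_NNB n).1 s d i c k _ hk hsd his hid ?_))
    (.append (plays_largest hk hsi hds hdi (hi' k))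
      (.append (.snoc (hi' k) ((transports_909_727 n).1.2 d s i k c _ hk' hds hid his ?_))
        (.append (plays_largest hk' hid hsi hsd (hd' c))
          (.snoc (hd' c) (plays_detour hk hid hsi hsd (by simp [allows_paint, hsd, hs])
            (by simp [allows_paint, hid, hi']) (by simp [allows_paint])))))) <;>
    (clear hk'; subst hk; simp [ReqNRB, ReqRNN, allows_paint, paint_eq_none, *])

theorem solves_solveUp606 (N : ℕ) : Solves free N (solveUp606 N .S .D .I) := by
  rcases N with _ | n
  · exact Subsingleton.elim _ _
  have hf : ∀ p e, Allows free p e := fun p e => allows_of_none rfl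
  rw [Solves]
  simp only [solveUp606, List.append_assoc, Config.tower_succ]
  refine .append (.snoc (hf _ _) ((transports_RNN_NNB n).1 .S .I .D .red .blue _ rfl
      (by decide) (by decide) (by decide) ?_))
    (.append (plays_largest rfl (by decide) (by decide) (by decide) (hf _ _))
      (.snoc (hf _ _) (plays_moveAllButNUp606 n rfl (by decide) (by decide) (by decide) ?_ ?_ ?_)))
    <;> simp [ReqRNN, allows_paint, paint_eq_none, free, Color.flip]

theorem solves_solveDown606 (N : ℕ) : Solves free N (solveDown606 N .S .D .I) := by
  rcases N with _ | n
  · exact Subsingleton.elim _ _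
  have hf : ∀ p e, Allows free p e := fun p e => allows_of_none rfl
  rw [Solves]
  simp only [solveDown606, List.append_assoc, Config.tower_succ]
  refine .append (.snoc (hf _ _) (plays_moveAllButNDown606 n rfl (by decide) (by decide)
      (by decide) ?_ ?_ ?_))
    (.append (plays_largest rfl (by decide) (by decide) (by decide) (hf _ _))
      (.snoc (hf _ _) ((transports_RNN_NNB n).2 .I .D .S .red .blue _ rfl
        (by decide) (by decide) (by decide) ?_)))
    <;> simp [ReqNNB, allows_paint, paint_eq_none, free]

/-! ### Counting moves -/

/-- The total weight of a list of moves when a move of disk `j` has weight `w j`. -/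
def weight (w : ℕ → ℕ) (L : List Move) : ℕ := (L.map fun m => w m.disk).sum

@[simp] theorem weight_nil (w : ℕ → ℕ) : weight w [] = 0 := rfl

@[simp] theorem weight_append (w : ℕ → ℕ) (L L' : List Move) :
    weight w (L ++ L') = weight w L + weight w L' := by simp [weight]

@[simp] theorem weight_singleton (w : ℕ → ℕ) (m : Move) : weight w [m] = w m.disk := by
  simp [weight]

theorem weight_one (L : List Move) : weight 1 L = L.length := by
  induction L with
  | nil => rfl
  | cons m L ih => simp_all [weight, add_comm]

theorem weight_single (j : ℕ) (L : List Move) : weight (Pi.single j 1) L = movesOf j L := by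
  induction L with
  | nil => rfl
  | cons m L ih =>
    simp only [weight, movesOf, List.map_cons, List.sum_cons, List.countP_cons] at ih ⊢
    rw [ih, add_comm]
    simp [Pi.single_apply]

section Weights

variable (w : ℕ → ℕ)

theorem weight_1000 (n : ℕ) : ∀ s d i, weight w (SRBB1000 n s d i) = full w n ∧
    weight w (SRRB1000 n s d i) = full w n := by
  induction n with
  | zero => intro s d i; simp [SRBB1000, SRRB1000, full]
  | succ n ih =>
    intro s d i
    simp only [SRBB1000, SRRB1000, full, weight_append, weight_singleton, (ih _ _ _).1,
      (ih _ _ _).2]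
    omega

theorem weight_909_727 (n : ℕ) : ∀ s d i,
    (weight w (SRBN909 n s d i) + saved w n = full w n ∧
      weight w (SNRB909 n s d i) + saved w n = full w n) ∧
    (weight w (SRNB727 n s d i) + saved w (n + 1) = full w n ∧
      weight w (SBNR727 n s d i) + saved w (n + 1) = full w n) := by
  induction n using Nat.strong_induction_on with
  | _ n ih =>
  intro s d i
  rcases n with _ | _ | n
  · simp [SRBN909, SNRB909, SRNB727, SBNR727, full, saved]
  · simp [SRBN909, SNRB909, SRNB727, SBNR727, full, saved, SRBB1000, SRRB1000]
  have h0 := ih n (by omega)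
  have h1 := ih (n + 1) (by omega)
  have e1 : full w (n + 2) = 3 * full w (n + 1) + w (n + 1) := rfl
  have e2 : full w (n + 1) = 3 * full w n + w n := rfl
  have e3 : saved w (n + 3) = saved w (n + 1) + 2 * saved w n + 2 * full w n := rfl
  have a1 := h1 s i d
  have a2 := h1 i d s
  have a3 := h0 d i s
  have a4 := h0 i d s
  have a5 := h0 s i d
  have a6 := h0 i s d
  clear ih h0 h1
  refine ⟨⟨?_, ?_⟩, ?_, ?_⟩
  on_goal 1 => rw [SRBN909]
  on_goal 2 => rw [SNRB909]
  on_goal 3 => rw [SRNB727]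
  on_goal 4 => rw [SBNR727]
  all_goals
    simp only [weight_append, weight_singleton, (weight_1000 w _ _ _ _).1,
      (weight_1000 w _ _ _ _).2, Nat.add_assoc, Nat.reduceAdd] at *
    linarith

theorem weight_636 (n : ℕ) : ∀ s d i,
    weight w (SRNN636 n s d i) + saved w n + saved w (n + 1) = full w n ∧
      weight w (SNNB636 n s d i) + saved w n + saved w (n + 1) = full w n := by
  induction n using Nat.strong_induction_on with
  | _ n ih =>
  intro s d i
  rcases n with _ | _ | n
  · simp [SRNN636, SNNB636, full, saved]
  · simp [SRNN636, SNNB636, full, saved]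
  have h0 := weight_909_727 w n
  have h1 := ih (n + 1) (by omega)
  have e1 : full w (n + 2) = 3 * full w (n + 1) + w (n + 1) := rfl
  have e2 : full w (n + 1) = 3 * full w n + w n := rfl
  have e3 : saved w (n + 3) = saved w (n + 1) + 2 * saved w n + 2 * full w n := rfl
  have a1 := h1 s i d
  have a2 := h1 i d s
  have a3 := h0 d i s
  have a4 := h0 i d s
  have a5 := h0 s i d
  have a6 := h0 i s d
  clear ih h0 h1
  refine ⟨?_, ?_⟩
  on_goal 1 => rw [SRNN636]
  on_goal 2 => rw [SNNB636]
  all_goals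
    simp only [weight_append, weight_singleton, (weight_1000 w _ _ _ _).1,
      (weight_1000 w _ _ _ _).2, Nat.add_assoc, Nat.reduceAdd] at *
    linarith

theorem weight_606 (n : ℕ) (s d i : Post) :
    weight w (solveUp606 (n + 1) s d i) + saved w n + saved w (n + 1) + saved w (n + 2) =
        full w (n + 1) ∧
      weight w (solveDown606 (n + 1) s d i) + saved w n + saved w (n + 1) + saved w (n + 2) =
        full w (n + 1) := by
  rcases n with _ | n
  · simp [solveUp606, solveDown606, SRNN636, SNNB636, moveAllButNUp606, moveAllButNDown606, full,
      saved]
  simp only [solveUp606, solveDown606, moveAllButNUp606, moveAllButNDown606, weight_append,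
    weight_singleton, (weight_1000 w _ _ _ _).1, (weight_1000 w _ _ _ _).2]
  have e1 : full w (n + 2) = 3 * full w (n + 1) + w (n + 1) := rfl
  have e2 : full w (n + 1) = 3 * full w n + w n := rfl
  have e3 : saved w (n + 3) = saved w (n + 1) + 2 * saved w n + 2 * full w n := rfl
  have a1 := weight_636 w (n + 1) s i d
  have a2 := weight_636 w (n + 1) i d s
  have a3 := weight_909_727 w n d i s
  have a4 := weight_636 w n i d s
  have a5 := weight_636 w n s i d
  have a6 := weight_909_727 w n i s d
  refine ⟨?_, ?_⟩ <;> simp only [Nat.add_assoc, Nat.reduceAdd] at * <;> omega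

end Weights

/-- The recurrence of the `606` procedure, with the procedures that it calls. -/
theorem weight_606_succ (w : ℕ → ℕ) (n : ℕ) :
    weight w (solveUp606 (n + 2) .S .D .I) =
      weight w (SRNN636 (n + 1) .S .D .I) + weight w (SRNN636 n .S .D .I) +
        weight w (SRBN909 n .S .D .I) + 2 * weight w (SRBB1000 n .S .D .I) +
          (w (n + 1) + 2 * w n) := by
  simp only [solveUp606, moveAllButNUp606, weight_append, weight_singleton,
    (weight_1000 w _ _ _ _).1, (weight_1000 w _ _ _ _).2]
  have a1 := weight_636 w (n + 1) .S .I .D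
  have a2 := weight_636 w (n + 1) .S .D .I
  have a3 := weight_636 w n .I .D .S
  have a4 := weight_636 w n .S .D .I
  have a5 := weight_909_727 w n .D .I .S
  have a6 := weight_909_727 w n .S .D .I
  omega

theorem full_single_eq_zero {j n : ℕ} (h : n ≤ j) : full (Pi.single j 1) n = 0 := by
  induction n with
  | zero => rfl
  | succ n ih => simp [full, ih (by omega), show n ≠ j by omega]

theorem saved_single_eq_zero {j n : ℕ} (h : n ≤ j + 2) : saved (Pi.single j 1) n = 0 := by
  induction n using Nat.strong_induction_on with
  | _ n ih =>
  rcases n with _ | _ | _ | n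
  iterate 3 rfl
  rw [saved, ih _ (by omega) (by omega), ih _ (by omega) (by omega),
    full_single_eq_zero (by omega)]

/-- The moves of disk `j` among `j + n` disks are those of the smallest disk among `n` disks. -/
theorem full_shift (j n : ℕ) : full (Pi.single j 1) (j + n) = full (Pi.single 0 1) n := by
  induction n with
  | zero => exact full_single_eq_zero le_rfl
  | succ n ih =>
    rw [← Nat.add_assoc, full, ih, full]
    simp [Pi.single_apply]

theorem saved_shift (j n : ℕ) : saved (Pi.single j 1) (j + n) = saved (Pi.single 0 1) n := by
  induction n using Nat.strong_induction_on with
  | _ n ih =>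
  rcases n with _ | _ | _ | n
  iterate 3 exact saved_single_eq_zero (by omega)
  rw [show j + (n + 3) = j + n + 3 by omega, saved, full_shift, ih n (by omega),
    show j + n + 1 = j + (n + 1) by omega, ih (n + 1) (by omega), saved]

/-- The disks move in the runs with different numbers of disks as often as their ranks from the
largest disk say. -/
theorem movesOf_606 {N k : ℕ} (hk : 1 ≤ k) (hN : k ≤ N) :
    movesOf (N - k) (solveUp606 N .S .D .I) = P606 k ∧
      movesOf (N - k) (solveDown606 N .S .D .I) = P606 k := by
  obtain ⟨j, rfl⟩ : ∃ j, N = j + k := ⟨N - k, by omega⟩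
  obtain ⟨k, rfl⟩ : ∃ m, k = m + 1 := ⟨k - 1, by omega⟩
  have h := weight_606 (Pi.single j 1) (j + k) .S .D .I
  have h0 := (weight_606 (Pi.single 0 1) k .S .D .I).1
  simp only [weight_single, Nat.add_assoc, saved_shift, full_shift] at h h0
  rw [Nat.add_sub_cancel, P606]
  omega

/-! ### The roots of the characteristic polynomial -/

/-- `x`, `y`, `z` are the roots of `X ^ 3 - X - 2`: these are Vieta's formulas, the second one
simplified by the first. -/
def Roots (x y z : ℂ) : Prop := x + y + z = 0 ∧ y * z = x ^ 2 - 1 ∧ x * y * z = 2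

theorem cbrt_pow {x : ℝ} (hx : 0 ≤ x) : cbrt x ^ 3 = x := by
  rw [cbrt, ← Real.rpow_natCast, ← Real.rpow_mul hx]
  norm_num

theorem cbrt_mul {x y : ℝ} (hx : 0 ≤ x) (hy : 0 ≤ y) : cbrt (x * y) = cbrt x * cbrt y :=
  Real.mul_rpow hx hy

/-- Cardano's formula: with `u` and `v` the two cube roots in `lam1`, `u ^ 3 + v ^ 3 = 2` and
`u * v = 1 / 3`, and the bracket in `lam2` and `lam3` is `√3 * (u - v)`. -/
theorem roots_lam : Roots lam1 lam2 lam3 := by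
  set u := cbrt (1 + √(26 / 27)) with hu
  set v := cbrt (1 - √(26 / 27)) with hv
  have hsq : √(26 / 27 : ℝ) ^ 2 = 26 / 27 := Real.sq_sqrt (by norm_num)
  have h0 : 0 ≤ √(26 / 27 : ℝ) := Real.sqrt_nonneg _
  have h1 : √(26 / 27 : ℝ) ≤ 1 := by nlinarith
  have hu3 : u ^ 3 = 1 + √(26 / 27) := cbrt_pow (by linarith)
  have hv3 : v ^ 3 = 1 - √(26 / 27) := cbrt_pow (by linarith)
  have huv : u * v = 1 / 3 := by
    rw [hu, hv, ← cbrt_mul (by linarith) (by linarith),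
      show (1 + √(26 / 27)) * (1 - √(26 / 27)) = (1 / 3 : ℝ) ^ 3 by nlinarith, cbrt,
      ← Real.rpow_natCast, ← Real.rpow_mul (by norm_num)]
    norm_num
  -- `√27 ± √26 = √27 * (1 ± √(26 / 27))`, and the cube root of `√27` is `√3`
  have h27 : cbrt √27 = √3 := by
    rw [show (27 : ℝ) = 3 ^ 2 * 3 by norm_num, Real.sqrt_mul (by norm_num),
      Real.sqrt_sq (by norm_num), show (3 : ℝ) * √3 = √3 ^ 3 by
        rw [pow_succ, Real.sq_sqrt (by norm_num)], cbrt, ← Real.rpow_natCast,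
      ← Real.rpow_mul (Real.sqrt_nonneg _)]
    norm_num
  have h26 : √26 = √27 * √(26 / 27) := by
    rw [← Real.sqrt_mul (by norm_num)]; norm_num
  have hd : cbrt (√27 + √26) - cbrt (√27 - √26) = √3 * (u - v) := by
    rw [h26, show √27 + √27 * √(26 / 27) = √27 * (1 + √(26 / 27)) by ring,
      show √27 - √27 * √(26 / 27) = √27 * (1 - √(26 / 27)) by ring,
      cbrt_mul (Real.sqrt_nonneg _) (by linarith), cbrt_mul (Real.sqrt_nonneg _) (by linarith), h27]
    ring
  have hl1 : lam1 = (u : ℂ) + v := by rw [lam1]; push_cast; rfl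
  have huvC : (u : ℂ) * v = 1 / 3 := by
    rw [← Complex.ofReal_mul, huv]; norm_num
  have hsum : (u : ℂ) ^ 3 + (v : ℂ) ^ 3 = 2 := by
    have : u ^ 3 + v ^ 3 = 2 := by rw [hu3, hv3]; ring
    exact_mod_cast congrArg (Complex.ofReal) this
  have h3 : (√3 : ℂ) ^ 2 = 3 := by
    exact_mod_cast congrArg (Complex.ofReal) (Real.sq_sqrt (show (0 : ℝ) ≤ 3 by norm_num))
  have hprod : lam2 * lam3 = lam1 ^ 2 - 1 := by
    rw [lam2, lam3, hd, hl1]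
    push_cast
    linear_combination (-(1 / 4) * (√3 : ℂ) ^ 2 * ((u : ℂ) - v) ^ 2) * Complex.I_sq
      + (1 / 4 * ((u : ℂ) - v) ^ 2) * h3 - 3 * huvC
  refine ⟨by rw [lam2, lam3]; ring, hprod, ?_⟩
  rw [mul_assoc, hprod, hl1]
  linear_combination hsum + 3 * ((u : ℂ) + v) * huvC

section Lagrange

variable {x y z : ℂ}

theorem Roots.rotate (h : Roots x y z) : Roots y x z ∧ Roots z x y := by
  obtain ⟨h1, h2, h3⟩ := h
  refine ⟨⟨by linear_combination h1, ?_, by linear_combination h3⟩,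
    ⟨by linear_combination h1, ?_, by linear_combination h3⟩⟩
  · linear_combination (x - y) * h1 + h2
  · linear_combination (x - z) * h1 + h2

theorem Roots.cube (h : Roots x y z) : x ^ 3 = x + 2 := by
  obtain ⟨h1, h2, h3⟩ := h
  linear_combination h3 - x * h2

theorem Roots.ne (h : Roots x y z) : x ≠ y := by
  rintro rfl
  obtain ⟨h1, h2, h3⟩ := h
  have hz : z = -2 * x := by linear_combination h1
  subst hz
  -- `3 * x ^ 2 = 1` and `x ^ 3 = -1`
  have e1 : 3 * x ^ 2 = 1 := by linear_combination -h2
  have e2 : x ^ 3 = -1 := by linear_combination -(1 / 2) * h3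
  have e3 : x = -3 := by linear_combination -x * e1 + 3 * e2
  rw [e3] at e2
  norm_num at e2

theorem sum_quadratic_div (hxy : x ≠ y) (hxz : x ≠ z) (hyz : y ≠ z) (α β γ : ℂ) :
    (α + β * x + γ * x ^ 2) / ((y - x) * (z - x)) + (α + β * y + γ * y ^ 2) / ((x - y) * (z - y)) +
      (α + β * z + γ * z ^ 2) / ((x - z) * (y - z)) = γ := by
  have h1 : y - x ≠ 0 := sub_ne_zero.2 hxy.symm
  have h2 : z - x ≠ 0 := sub_ne_zero.2 hxz.symm
  have h3 : z - y ≠ 0 := sub_ne_zero.2 hyz.symm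
  rw [← neg_sub y x, ← neg_sub z x, ← neg_sub z y]
  field_simp
  ring

end Lagrange

/-- The common shape of `coeffS` and `coeffP`. -/
noncomputable def coeff (p q r x y z : ℂ) : ℂ :=
  (p * (y * z) + q * (y + z) + r) / ((y - x) * (z - x))

theorem coeffS_eq (x y z : ℂ) : coeffS x y z = coeff (7 / 11) (-(10 / 11)) (19 / 11) x y z := by
  rw [coeffS, coeff]; ring_nf

theorem coeffP_eq (x y z : ℂ) : coeffP x y z = coeff (1 / 11) (-(3 / 11)) (9 / 11) x y z := by
  rw [coeffP, coeff]; ring_nf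

/-- The combination of powers of the roots in the closed forms. -/
noncomputable def powerSum (p q r : ℂ) (n : ℕ) : ℂ :=
  1 / 2 * coeff p q r lam1 lam2 lam3 * (lam1 + 1) ^ 2 * lam1 ^ n +
    1 / 2 * coeff p q r lam2 lam1 lam3 * (lam2 + 1) ^ 2 * lam2 ^ n +
    1 / 2 * coeff p q r lam3 lam1 lam2 * (lam3 + 1) ^ 2 * lam3 ^ n

theorem powerSum_add_three (p q r : ℂ) (n : ℕ) :
    powerSum p q r (n + 3) = powerSum p q r (n + 1) + 2 * powerSum p q r n := by
  have h1 := roots_lam.cube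
  have h2 := roots_lam.rotate.1.cube
  have h3 := roots_lam.rotate.2.cube
  simp only [powerSum, pow_add, h1, h2, h3]
  ring

/-- If the numerator of the coefficient times `(x + 1) ^ 2 * x ^ n` reduces to a quadratic
polynomial modulo `X ^ 3 - X - 2`, then, by Lagrange interpolation, its leading coefficient gives
the sum. -/
theorem powerSum_of_reduction {p q r α β γ : ℂ} {n : ℕ}
    (h : ∀ x y z, Roots x y z → (p * (y * z) + q * (y + z) + r) * (x + 1) ^ 2 * x ^ n =
      α + β * x + γ * x ^ 2) : powerSum p q r n = 1 / 2 * γ := by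
  have hr := roots_lam
  have hr2 := hr.rotate.1
  have hr3 := hr.rotate.2
  have key : ∀ x y z, Roots x y z → 1 / 2 * coeff p q r x y z * (x + 1) ^ 2 * x ^ n =
      1 / 2 * ((α + β * x + γ * x ^ 2) / ((y - x) * (z - x))) := by
    intro x y z hxyz
    rw [← h x y z hxyz, coeff]
    ring
  rw [powerSum, key _ _ _ hr, key _ _ _ hr2, key _ _ _ hr3]
  linear_combination 1 / 2 * sum_quadratic_div hr.ne hr3.ne.symm hr3.rotate.2.ne α β γ

theorem powerSum_zero (p q r : ℂ) : powerSum p q r 0 = 1 / 2 * (p - 2 * q + r) := by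
  refine powerSum_of_reduction (α := 3 * p - 2 * q + r) (β := 2 * p - 2 * q + 2 * r)
    fun x y z h => ?_
  rw [h.2.1, show y + z = -x by linear_combination h.1]
  linear_combination (p * x + 2 * p - q) * h.cube

theorem powerSum_one (p q r : ℂ) : powerSum p q r 1 = 1 / 2 * (2 * p - 2 * q + 2 * r) := by
  refine powerSum_of_reduction (α := 2 * (p - 2 * q + r)) (β := 4 * p - 4 * q + 2 * r)
    fun x y z h => ?_
  rw [h.2.1, show y + z = -x by linear_combination h.1]
  linear_combination (p * x ^ 2 + (2 * p - q) * x + (p - 2 * q + r)) * h.cube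

theorem powerSum_two (p q r : ℂ) : powerSum p q r 2 = 1 / 2 * (4 * p - 4 * q + 2 * r) := by
  refine powerSum_of_reduction (α := 2 * (2 * p - 2 * q + 2 * r))
    (β := (2 * p - 2 * q + 2 * r) + 2 * (p - 2 * q + r)) fun x y z h => ?_
  rw [h.2.1, show y + z = -x by linear_combination h.1]
  linear_combination (p * x ^ 3 + (2 * p - q) * x ^ 2 + (p - 2 * q + r) * x +
    (2 * p - 2 * q + 2 * r)) * h.cube

theorem eq_of_recurrence {R : Type*} [CommRing R] {u v : ℕ → R}
    (hu : ∀ n, u (n + 3) = u (n + 1) + 2 * u n) (hv : ∀ n, v (n + 3) = v (n + 1) + 2 * v n)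
    (h0 : u 0 = v 0) (h1 : u 1 = v 1) (h2 : u 2 = v 2) (n : ℕ) : u n = v n := by
  induction n using Nat.strong_induction_on with
  | _ n ih =>
  rcases n with _ | _ | _ | n
  · exact h0
  · exact h1
  · exact h2
  · rw [hu, hv, ih _ (by omega), ih _ (by omega)]

/-! ### Closed forms and the limit -/

theorem full_one (n : ℕ) : (full 1 n : ℝ) = (3 ^ n - 1) / 2 := by
  induction n with
  | zero => simp [full]
  | succ n ih => simp only [full, Pi.one_apply]; push_cast; rw [ih]; ring

theorem full_single_zero (n : ℕ) : full (Pi.single 0 1) (n + 1) = 3 ^ n := by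
  induction n with
  | zero => simp [full]
  | succ n ih => rw [full, ih]; simp [pow_succ, mul_comm]

/-- The recursion of `saved` carries over to the 606 procedure; the last summand is its
inhomogeneity. -/
theorem weight_606_recurrence (w : ℕ → ℕ) (n : ℕ) :
    (weight w (solveUp606 (n + 4) .S .D .I) : ℝ) =
      weight w (solveUp606 (n + 2) .S .D .I) + 2 * weight w (solveUp606 (n + 1) .S .D .I) +
        (full w (n + 4) - 3 * full w (n + 2) - 4 * full w (n + 1) - 2 * full w n) := by
  have h (m : ℕ) := congrArg (Nat.cast (R := ℝ)) (weight_606 w m .S .D .I).1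
  have s (m : ℕ) := congrArg (Nat.cast (R := ℝ))
    (show saved w (m + 3) = saved w (m + 1) + 2 * saved w m + 2 * full w m from rfl)
  push_cast at h s
  linear_combination h (n + 3) - h (n + 1) - 2 * h n - s n - s (n + 1) - s (n + 2)

/-- What remains of `S606 (n + 1)` after removing the terms from the roots `3` and `1`. -/
noncomputable def remainderS (n : ℕ) : ℝ := S606 (n + 1) - 10 / 33 * 3 ^ (n + 1) + 2

theorem remainderS_add_three (n : ℕ) :
    remainderS (n + 3) = remainderS (n + 1) + 2 * remainderS n := by
  have h := weight_606_recurrence 1 n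
  simp only [full_one] at h
  simp only [remainderS, S606, ← weight_one]
  rw [h]
  ring

theorem S606_add_two (n : ℕ) :
    S606 (n + 2) = S636 (n + 1) + S636 n + S909 n + 2 * S1000 n + 3 := by
  have h := weight_606_succ 1 n
  simp only [weight_one, Pi.one_apply] at h
  exact h

theorem P606_add_three (n : ℕ) :
    P606 (n + 3) = P636 (n + 2) + P636 (n + 1) + P909 (n + 1) + 2 * P1000 (n + 1) := by
  have h := weight_606_succ (Pi.single 0 1) (n + 1)
  simp [weight_single] at h
  exact h

theorem S606_small : S606 1 = 1 ∧ S606 2 = 4 ∧ S606 3 = 11 := by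
  have h (m : ℕ) := (weight_606 1 m .S .D .I).1
  have h0 := h 0
  have h1 := h 1
  have h2 := h 2
  simp [full, saved, weight_one] at h0 h1 h2
  exact ⟨h0, h1, h2⟩

theorem P606_small : P606 1 = 1 ∧ P606 2 = 3 ∧ P606 3 = 7 ∧ P606 4 = 19 := by
  have h (m : ℕ) := (weight_606 (Pi.single 0 1) m .S .D .I).1
  have h0 := h 0
  have h1 := h 1
  have h2 := h 2
  have h3 := h 3
  simp [full, saved, weight_single] at h0 h1 h2 h3
  exact ⟨h0, h1, h2, by rw [P606]; omega⟩

theorem remainderS_eq_powerSum (n : ℕ) :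
    (remainderS n : ℂ) = powerSum (7 / 11) (-(10 / 11)) (19 / 11) n := by
  obtain ⟨h1, h2, h3⟩ := S606_small
  refine eq_of_recurrence (u := fun n => (remainderS n : ℂ)) (fun n => ?_)
    (powerSum_add_three _ _ _) ?_ ?_ ?_ n
  · simp only [remainderS_add_three]; push_cast; ring
  · rw [powerSum_zero, remainderS, h1]; push_cast; norm_num
  · rw [powerSum_one, remainderS, h2]; push_cast; norm_num
  · rw [powerSum_two, remainderS, h3]; push_cast; norm_num

theorem S606_closed_form (n : ℕ) : (S606 (n + 1) : ℂ) =
    10 / 33 * 3 ^ (n + 1) + powerSum (7 / 11) (-(10 / 11)) (19 / 11) n - 2 := by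
  rw [← remainderS_eq_powerSum, remainderS]
  push_cast
  ring

/-- What remains of `P606 (n + 2)` after removing the term from the root `3`. -/
noncomputable def remainderP (n : ℕ) : ℝ := P606 (n + 2) - 20 / 33 * 3 ^ (n + 1)

theorem remainderP_add_three (n : ℕ) :
    remainderP (n + 3) = remainderP (n + 1) + 2 * remainderP n := by
  have h := weight_606_recurrence (Pi.single 0 1) (n + 1)
  simp only [full_single_zero, weight_single, Nat.add_assoc, Nat.reduceAdd] at h
  simp only [remainderP, P606, Nat.add_assoc, Nat.reduceAdd]
  rw [h]
  push_cast
  ring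

theorem P606_closed_form (n : ℕ) : (P606 (n + 2) : ℂ) =
    20 / 33 * 3 ^ (n + 1) + powerSum (1 / 11) (-(3 / 11)) (9 / 11) (n + 1) := by
  have key : (remainderP n : ℂ) = powerSum (1 / 11) (-(3 / 11)) (9 / 11) (n + 1) := by
    obtain ⟨-, h1, h2, h3⟩ := P606_small
    refine eq_of_recurrence (u := fun n => (remainderP n : ℂ))
      (v := fun n => powerSum (1 / 11) (-(3 / 11)) (9 / 11) (n + 1)) (fun n => ?_)
      (fun n => powerSum_add_three _ _ _ (n + 1)) ?_ ?_ ?_ n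
    · simp only [remainderP_add_three]; push_cast; ring
    · rw [powerSum_one, remainderP, h1]; push_cast; norm_num
    · rw [powerSum_two, remainderP, h2]; push_cast; norm_num
    · rw [powerSum_add_three, powerSum_zero, powerSum_one, remainderP, h3]; push_cast; norm_num
  rw [← key, remainderP]
  push_cast
  ring

/-- The roots have absolute value less than `2`; the bound follows from the recursion alone. -/
theorem abs_remainderS_le (n : ℕ) : |remainderS n| ≤ 3 * 2 ^ n := by
  induction n using Nat.strong_induction_on with
  | _ n ih =>
  obtain ⟨h1, h2, h3⟩ := S606_small
  rcases n with _ | _ | _ | n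
  · rw [remainderS, h1]; norm_num [abs_le]
  · rw [remainderS, h2]; norm_num [abs_le]
  · rw [remainderS, h3]; norm_num [abs_le]
  · have a0 := abs_le.1 (ih n (by omega))
    have a1 := abs_le.1 (ih (n + 1) (by omega))
    have hp : (0 : ℝ) < 2 ^ n := by positivity
    rw [remainderS_add_three, abs_le]
    simp only [pow_succ] at a1 ⊢
    constructor <;> linarith [a0.1, a0.2, a1.1, a1.2]

theorem tendsto_S606 :
    Tendsto (fun N : ℕ => (S606 N : ℝ) / ((3 ^ N - 1) / 2)) atTop (𝓝 (20 / 33)) := by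
  rw [← tendsto_add_atTop_iff_nat 1]
  have hrem : Tendsto (fun n : ℕ => remainderS n / 3 ^ n) atTop (𝓝 0) := by
    have h2 : Tendsto (fun n : ℕ => 3 * (2 / 3 : ℝ) ^ n) atTop (𝓝 0) := by
      simpa using (tendsto_pow_atTop_nhds_zero_of_lt_one (by norm_num)
        (by norm_num : (2 / 3 : ℝ) < 1)).const_mul 3
    refine squeeze_zero_norm (fun n => ?_) h2
    rw [norm_div, Real.norm_eq_abs, norm_pow, div_pow, ← mul_div_assoc]
    norm_num
    gcongr
    exact abs_remainderS_le n
  have hpow : Tendsto (fun n : ℕ => (1 / 3 : ℝ) ^ n) atTop (𝓝 0) :=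
    tendsto_pow_atTop_nhds_zero_of_lt_one (by norm_num) (by norm_num)
  -- numerator and denominator divided by `3 ^ n`
  have hmain : Tendsto (fun n : ℕ => (10 / 11 - 2 * (1 / 3 : ℝ) ^ n + remainderS n / 3 ^ n) /
      ((3 - (1 / 3 : ℝ) ^ n) / 2)) atTop (𝓝 ((10 / 11 - 2 * 0 + 0) / ((3 - 0) / 2))) :=
    ((tendsto_const_nhds.sub (hpow.const_mul 2)).add hrem).div
      ((tendsto_const_nhds.sub hpow).div_const 2) (by norm_num)
  refine (hmain.congr fun n => ?_).trans_eq (by norm_num)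
  have hS : (S606 (n + 1) : ℝ) = 10 / 33 * 3 ^ (n + 1) - 2 + remainderS n := by
    rw [remainderS]; ring
  have h3 : (3 : ℝ) ^ n ≠ 0 := by positivity
  have h4 : (3 : ℝ) ^ (n + 1) - 1 ≠ 0 := by
    have : (1 : ℝ) < 3 ^ (n + 1) := one_lt_pow₀ (by norm_num) (by omega)
    linarith
  have h5 : (3 : ℝ) ^ n * 3 - 1 ≠ 0 := by rwa [pow_succ] at h4
  rw [hS, one_div, inv_pow, pow_succ]
  have h6 : 3 - ((3 : ℝ) ^ n)⁻¹ ≠ 0 := by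
    intro h
    apply h5
    field_simp at h
    linarith
  field_simp
  ring

/-! ### Optimality -/

theorem length_606 (N : ℕ) : (solveUp606 N .S .D .I).length = S606 N ∧
    (solveDown606 N .S .D .I).length = S606 N := by
  refine ⟨rfl, ?_⟩
  rcases N with _ | n
  · rfl
  have h := weight_606 1 n .S .D .I
  simp only [weight_one] at h
  rw [S606]
  omega

theorem S606_le_length {N : ℕ} {L : List Move} (h : Solves free N L) : S606 N ≤ L.length := by
  rcases N with _ | n
  · exact Nat.zero_le _
  have h1 := le_length_of_solves h
  have h2 := (weight_606 1 n .S .D .I).1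
  rw [weight_one] at h2
  rw [S606]
  omega

theorem isOptimalSolution_606 (N : ℕ) : IsOptimalSolution free N (solveUp606 N .S .D .I) ∧
    IsOptimalSolution free N (solveDown606 N .S .D .I) :=
  ⟨⟨solves_solveUp606 N, fun _ h => (length_606 N).1.trans_le (S606_le_length h)⟩,
    ⟨solves_solveDown606 N, fun _ h => (length_606 N).2.trans_le (S606_le_length h)⟩⟩

theorem minMoves_eq (N : ℕ) : minMoves free N = S606 N := by
  refine le_antisymm (Nat.sInf_le ⟨_, solves_solveUp606 N, (length_606 N).1⟩) ?_
  refine le_csInf ⟨_, _, solves_solveUp606 N, rfl⟩ ?_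
  rintro _ ⟨L, hL, rfl⟩
  exact S606_le_length hL

theorem S1000_eq (N : ℕ) : (S1000 N : ℝ) = (3 ^ N - 1) / 2 := by
  rw [S1000, ← weight_one, (weight_1000 1 N _ _ _).1, full_one]

end MToH

theorem mainTheorem1 :
    -- both versions solve the Free puzzle in the minimum possible number of moves
    (∀ N : ℕ,
      MToH.IsOptimalSolution MToH.free N
        (MToH.solveUp606 N MToH.Post.S MToH.Post.D MToH.Post.I) ∧
      MToH.IsOptimalSolution MToH.free N
        (MToH.solveDown606 N MToH.Post.S MToH.Post.D MToH.Post.I)) ∧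
    -- the minimum number of moves is `S606 N`, the number of moves of either version
    (∀ N : ℕ,
      (MToH.solveUp606 N MToH.Post.S MToH.Post.D MToH.Post.I).length = MToH.S606 N ∧
      (MToH.solveDown606 N MToH.Post.S MToH.Post.D MToH.Post.I).length = MToH.S606 N ∧
      MToH.minMoves MToH.free N = MToH.S606 N) ∧
    -- the recurrence for the total number of moves
    (MToH.S606 1 = 1 ∧ MToH.S606 2 = 4 ∧
      ∀ N : ℕ, 1 ≤ N →
        MToH.S606 (N + 1) =
          MToH.S636 N + MToH.S636 (N - 1) + MToH.S909 (N - 1) + 2 * MToH.S1000 (N - 1) + 3) ∧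
    -- the `k`-th largest disk makes `P606 k` moves, however many disks there are
    (∀ N k : ℕ, 1 ≤ k → k ≤ N →
      MToH.movesOf (N - k) (MToH.solveUp606 N MToH.Post.S MToH.Post.D MToH.Post.I)
        = MToH.P606 k ∧
      MToH.movesOf (N - k) (MToH.solveDown606 N MToH.Post.S MToH.Post.D MToH.Post.I)
        = MToH.P606 k) ∧
    -- the recurrence for the number of moves of the single disks
    (MToH.P606 1 = 1 ∧ MToH.P606 2 = 3 ∧
      ∀ k : ℕ, 2 ≤ k →
        MToH.P606 (k + 1) =
          MToH.P636 k + MToH.P636 (k - 1) + MToH.P909 (k - 1) + 2 * MToH.P1000 (k - 1)) ∧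
    -- the closed forms
    (∀ N : ℕ, 1 ≤ N →
      (MToH.S606 N : ℂ) =
        10 / 33 * 3 ^ N
          + 1 / 2 * MToH.AS * (MToH.lam1 + 1) ^ 2 * MToH.lam1 ^ (N - 1)
          + 1 / 2 * MToH.BS * (MToH.lam2 + 1) ^ 2 * MToH.lam2 ^ (N - 1)
          + 1 / 2 * MToH.CS * (MToH.lam3 + 1) ^ 2 * MToH.lam3 ^ (N - 1) - 2) ∧
    (∀ k : ℕ, 2 ≤ k →
      (MToH.P606 k : ℂ) =
        20 / 33 * 3 ^ (k - 1)
          + 1 / 2 * MToH.AP * (MToH.lam1 + 1) ^ 2 * MToH.lam1 ^ (k - 1)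
          + 1 / 2 * MToH.BP * (MToH.lam2 + 1) ^ 2 * MToH.lam2 ^ (k - 1)
          + 1 / 2 * MToH.CP * (MToH.lam3 + 1) ^ 2 * MToH.lam3 ^ (k - 1)) ∧
    -- the duration relative to the Colored tower, and its limit, also for the minimum
    (∀ N : ℕ, (MToH.S1000 N : ℝ) = (3 ^ N - 1) / 2) ∧
    Tendsto (fun N : ℕ => (MToH.S606 N : ℝ) / ((3 ^ N - 1) / 2)) atTop (𝓝 (20 / 33)) ∧
    Tendsto (fun N : ℕ => (MToH.minMoves MToH.free N : ℝ) / ((3 ^ N - 1) / 2)) atTop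
      (𝓝 (20 / 33)) := by
  refine ⟨MToH.isOptimalSolution_606, fun N => ⟨(MToH.length_606 N).1, (MToH.length_606 N).2,
    MToH.minMoves_eq N⟩, ⟨MToH.S606_small.1, MToH.S606_small.2.1, ?_⟩,
    fun N k hk hN => MToH.movesOf_606 hk hN, ⟨MToH.P606_small.1, MToH.P606_small.2.1, ?_⟩,
    ?_, ?_, MToH.S1000_eq, MToH.tendsto_S606, ?_⟩
  · intro N hN
    obtain ⟨n, rfl⟩ : ∃ n, N = n + 1 := ⟨N - 1, by omega⟩
    exact MToH.S606_add_two n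
  · intro k hk
    obtain ⟨n, rfl⟩ : ∃ n, k = n + 2 := ⟨k - 2, by omega⟩
    exact MToH.P606_add_three n
  · intro N hN
    obtain ⟨n, rfl⟩ : ∃ n, N = n + 1 := ⟨N - 1, by omega⟩
    rw [MToH.S606_closed_form, MToH.powerSum, MToH.AS, MToH.BS, MToH.CS]
    simp only [MToH.coeffS_eq, Nat.add_sub_cancel]
    ring
  · intro k hk
    obtain ⟨n, rfl⟩ : ∃ n, k = n + 2 := ⟨k - 2, by omega⟩
    rw [MToH.P606_closed_form, MToH.powerSum, MToH.AP, MToH.BP, MToH.CP]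
    simp only [MToH.coeffP_eq, show n + 2 - 1 = n + 1 by omega]
    ring
  · simpa only [MToH.minMoves_eq] using MToH.tendsto_S606
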